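/- Let $N\ge 3$, let $(t_1,\dots,t_N)$ be coordinates on $\mathbb R^N$ with $t_1=x$, and for a field $v:\mathbb R^N\to\mathbb R$ let $v_I$ denote its partial derivatives ($I$ a multi-index). A differential polynomial is a real polynomial in the symbols $v_I$; $\mathrm D_i=\sum_I v_{It_i}\,\partial/\partial v_I$ is the total derivative in the direction $t_i$, $\mathrm D_x=\mathrm D_1$, and $$\frac{\delta_{1}P}{\delta v_I}=\sum_{\alpha\ge0}(-1)^\alpha \mathrm D_1^\alpha\frac{\partial P}{\partial v_{Ix^\alpha}},\qquad \frac{\delta_{ij}P}{\delta v_I}=\sum_{\alpha,\beta\ge0}(-1)^{\alpha+\beta}\mathrm D_i^\alpha \mathrm D_j^\beta\frac{\partial P}{\partial v_{It_i^\alpha t_j^\beta}} .$$ Let $R=\sum_{k\ge0} r_k[u]\,z^{-2k-1}$ be the formal series with $r_0=\frac12$ and $RR_{xx}-\frac12R_x^2+2\left(u-\frac14z^2\right)R^2=-\frac18$ (so $r_1=u$, $r_2=u_{xx}+3u^2$, \dots), and put $g_k[v]=r_k[v_x]$ and $h_k=\frac1{4k+2}g_{k+1}$. The potential KdV (PKdV)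 equations are $v_{t_k}=g_k$. Let $b_{ij}$ be the differential polynomial without constant term such that $\mathrm D_x(b_{ij})=\mathrm D_x(g_i)\,g_j$, and let $a_{ij}=\sum_{\alpha\ge0}v_{x^\alpha t_j}\,\frac{\delta_1h_i}{\delta v_{x^{\alpha+1}}}$. Consider the Lagrangian two-form $\mathcal L=\sum_{i<j}L_{ij}\,dt_i\wedge dt_j$ with $$L_{1i}=\tfrac12v_xv_{t_i}-h_i\quad(i>1),\qquad L_{ij}=\tfrac12(v_{t_i}g_j-v_{t_j}g_i)+(a_{ij}-a_{ji})-\tfrac12(b_{ij}-b_{ji})\quad(j>i>1),$$ and set $L_{ji}=-L_{ij}$. Its multi-time Euler–Lagrange equations are, for distinct $i,j,k\in\{1,\dots,N\}$, $$\frac{\delta_{ij}L_{ij}}{\delta v_I}=0\ \ (t_i,t_j\notin I),\qquad \frac{\delta_{ij}L_{ij}}{\delta v_{It_j}}=\frac{\delta_{ik}L_{ik}}{\delta v_{It_k}}\ \ (t_i\notin I),\qquad \frac{\delta_{ij}L_{ij}}{\delta v_{It_it_j}}+\frac{\delta_{jk}L_{jk}}{\delta v_{It_jt_k}}+\frac{\delta_{ki}L_{ki}}{\delta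 v_{It_kt_i}}=0\ \ (\text{all } I).$$ A smooth field $v$ is said to solve the pluri-Lagrangian problem for $\mathcal L$ if it is a critical point of the action $\int_S\mathcal L$ on every smooth embedded surface patch $S\subset\mathbb R^N$, that is, $\int_S\sum_{i<j}\sum_I\frac{\partial L_{ij}}{\partial v_I}[v]\,w_I\,dt_i\wedge dt_j=0$ for every smooth $w:\mathbb R^N\to\mathbb R$ that vanishes near $\partial S$. Theorem. The multi-time Euler–Lagrange equations of $\mathcal L$ are the PKdV equations $v_{t_2}=g_2,\ \dots,\ v_{t_N}=g_N$ and equations that follow from these by differentiation. Precisely: 1. for each $k=2,\dots,N$ some non-zero constant multiple of the equation $v_{t_k}-g_k=0$ is one of the multi-time Euler–Lagrange equations; 2. for each multi-time Euler–Lagrange equation, the difference of its two sides lies in the differential ideal generated by $v_{t_2}-g_2,\dots,v_{t_N}-g_N$; 3. for every smooth $v:\mathbb R^N\to\mathbb R$, the following are equivalent: $v$ solves the pluri-Lagrangian problem for $\mathcal L$; $v$ satisfies all multi-time Euler–Lagrange equations of $\mathcal L$; $v$ satisfies $v_{t_k}=g_k$ for $k=2,\dots,N$. -/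

import Mathlib

open scoped ContDiff

noncomputable section

namespace PluriLagrangian

/-! ### The coefficients of the KdV resolvent

The construction is written for an arbitrary commutative real algebra `A` with a derivation `d`
(playing the role of the derivative in `x`) and an element `u`, so that the substitution of `v_x`
for `u` is literal. -/

section Resolvent

variable {A : Type*} [CommRing A] [Algebra ℝ A]

/-- The coefficients `r_k` of the formal series `R = ∑ r_k z^(-2k-1)`, with `r_0 = 1/2`, that solves
`R R_xx - (1/2) R_x^2 + 2 (u - z^2/4) R^2 = -1/8`. Comparing coefficients of `z^(-2m-2)` in this
equation determines `r_(m+1)` from `r_0, ..., r_m`; this is the recursion used here. -/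
def resolventCoeff (d : Derivation ℝ A A) (u : A) : ℕ → A
  | 0 => algebraMap ℝ A (1 / 2)
  | m + 1 =>
      2 * (∑ k : Fin (m + 1),
          (resolventCoeff d u k * d (d (resolventCoeff d u (m - k)))
            - (1 / 2 : ℝ) • (d (resolventCoeff d u k) * d (resolventCoeff d u (m - k)))
            + 2 * u * resolventCoeff d u k * resolventCoeff d u (m - k)))
        - ∑ k : Fin m, resolventCoeff d u (k + 1) * resolventCoeff d u (m - k)
  decreasing_by all_goals omega

/-- The polynomials `b_(kl)` with `d (b_(kl)) = d (r_k) * r_l` and without constant term. The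
recursion comes from `d (r_(k+1)) r_l + r_k d (r_(l+1)) = d (r_l r_k'' + r_k r_l'' - r_k' r_l' +
4 u r_k r_l)`. -/
def resolventB (d : Derivation ℝ A A) (u : A) : ℕ → ℕ → A
  | 0, _ => 0
  | k + 1, l =>
      resolventCoeff d u l * d (d (resolventCoeff d u k))
        + resolventCoeff d u k * d (d (resolventCoeff d u l))
        - d (resolventCoeff d u k) * d (resolventCoeff d u l)
        + 4 * u * resolventCoeff d u k * resolventCoeff d u l
        - resolventCoeff d u k * resolventCoeff d u (l + 1)
        + resolventB d u k (l + 1)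

theorem half_smul_eq (x y : A) (h : x = 2 * y) : (1 / 2 : ℝ) • x = y := by
  subst h
  have h2 : (2 : A) * y = (2 : ℝ) • y := by
    rw [Algebra.smul_def]; rw [map_ofNat]
  rw [h2, smul_smul]; norm_num

theorem d_resolventCoeff_zero (d : Derivation ℝ A A) (u : A) : d (resolventCoeff d u 0) = 0 := by
  rw [resolventCoeff]; exact d.map_algebraMap _

theorem two_mul_resolventCoeff_zero (d : Derivation ℝ A A) (u : A) :
    2 * resolventCoeff d u 0 = 1 := by
  rw [resolventCoeff]
  have h : (2 : A) = algebraMap ℝ A 2 := (map_ofNat (algebraMap ℝ A) 2).symm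
  rw [h, ← map_mul]; norm_num

/-- The coefficient of `z^(-2m-2)` in `R R_xx - (1/2) R_x^2 + 2 (u - z^2/4) R^2 = -1/8`; the
coefficient of `z^0` is `-(1/2) r_0^2 = -1/8`. -/
theorem resolvent_quadratic (d : Derivation ℝ A A) (u : A) (m : ℕ) :
    ∑ p ∈ Finset.HasAntidiagonal.antidiagonal m,
        (resolventCoeff d u p.1 * d (d (resolventCoeff d u p.2))
          - (1 / 2 : ℝ) • (d (resolventCoeff d u p.1) * d (resolventCoeff d u p.2))
          + 2 * u * resolventCoeff d u p.1 * resolventCoeff d u p.2)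
      - (1 / 2 : ℝ) • ∑ p ∈ Finset.HasAntidiagonal.antidiagonal (m + 1),
          resolventCoeff d u p.1 * resolventCoeff d u p.2 = 0 := by
  rw [sub_eq_zero]
  symm
  apply half_smul_eq
  have h0 := two_mul_resolventCoeff_zero d u
  have hm := resolventCoeff.eq_2 d u m
  rw [Finset.Nat.sum_antidiagonal_eq_sum_range_succ_mk,
    Finset.Nat.sum_antidiagonal_eq_sum_range_succ_mk, Finset.sum_range_succ,
    Finset.sum_range_succ', Finset.sum_range]
  simp only [Nat.add_sub_add_right, Nat.sub_zero, Nat.sub_self]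
  rw [Finset.sum_range]
  linear_combination hm + resolventCoeff d u (m + 1) * h0

/-- The coefficient of `z^(-2m-1)` in `R_xxx + 4 u R_x + 2 u_x R - z^2 R_x = 0`. -/
theorem resolvent_linear (d : Derivation ℝ A A) (u : A) (m : ℕ) :
    d (d (d (resolventCoeff d u m))) + 4 * u * d (resolventCoeff d u m)
      + 2 * d u * resolventCoeff d u m = d (resolventCoeff d u (m + 1)) := by
  set r := resolventCoeff d u with hr
  have key : ∀ n, ∑ p ∈ Finset.HasAntidiagonal.antidiagonal n,
      r p.1 * (d (d (d (r p.2))) + 4 * u * d (r p.2) + 2 * d u * r p.2 - d (r (p.2 + 1))) = 0 := by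
    intro n
    have hq := congrArg d (resolvent_quadratic d u n)
    have h2 : d (2 : A) = 0 := by
      have h : (2 : A) = algebraMap ℝ A 2 := (map_ofNat (algebraMap ℝ A) 2).symm
      rw [h]; exact d.map_algebraMap _
    simp only [← hr, map_sub, map_sum, map_add, Derivation.map_smul, Derivation.leibniz,
      smul_eq_mul, map_zero, h2, mul_zero, add_zero] at hq
    have e1 : (1 / 2 : ℝ) • ∑ p ∈ Finset.HasAntidiagonal.antidiagonal (n + 1),
        (r p.1 * d (r p.2) + r p.2 * d (r p.1)) =
        ∑ p ∈ Finset.HasAntidiagonal.antidiagonal n, r p.1 * d (r (p.2 + 1)) := by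
      apply half_smul_eq
      rw [Finset.sum_add_distrib,
        ← Finset.Nat.sum_antidiagonal_swap (n := n + 1) (f := fun p => r p.2 * d (r p.1))]
      simp only [Prod.fst_swap, Prod.snd_swap]
      rw [Finset.Nat.sum_antidiagonal_succ', d_resolventCoeff_zero]
      ring
    rw [e1] at hq
    simp only [mul_sub, Finset.sum_sub_distrib]
    rw [← hq]
    congr 1
    have e2 : ∀ p : ℕ × ℕ, r p.1 * d (d (d (r p.2))) + d (d (r p.2)) * d (r p.1) -
        (1 / 2 : ℝ) • (d (r p.1) * d (d (r p.2)) + d (r p.2) * d (d (r p.1))) +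
        (2 * u * r p.1 * d (r p.2) + r p.2 * (2 * u * d (r p.1) + r p.1 * (2 * d u))) =
        r p.1 * (d (d (d (r p.2))) + 4 * u * d (r p.2) + 2 * d u * r p.2)
        + (1 / 2 : ℝ) • (d (r p.1) * d (d (r p.2)) - d (r p.2) * d (d (r p.1)))
        + (2 * u) * (r p.2 * d (r p.1) - r p.1 * d (r p.2)) := by
      intro p
      have e3 : d (d (r p.2)) * d (r p.1)
          = (1 / 2 : ℝ) • (d (r p.1) * d (d (r p.2)) - d (r p.2) * d (d (r p.1)))
          + (1 / 2 : ℝ) • (d (r p.1) * d (d (r p.2)) + d (r p.2) * d (d (r p.1))) := by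
        rw [← smul_add]
        symm
        apply half_smul_eq
        ring
      linear_combination e3
    simp only [e2, Finset.sum_add_distrib, ← Finset.smul_sum, ← Finset.mul_sum,
      Finset.sum_sub_distrib]
    have s1 := Finset.Nat.sum_antidiagonal_swap (n := n) (f := fun p => d (r p.2) * d (d (r p.1)))
    have s2 := Finset.Nat.sum_antidiagonal_swap (n := n) (f := fun p => r p.2 * d (r p.1))
    simp only [Prod.fst_swap, Prod.snd_swap] at s1 s2
    rw [s1, s2]
    simp
  have h0 := two_mul_resolventCoeff_zero d u
  rw [← sub_eq_zero]
  induction m using Nat.strong_induction_on with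
  | _ m ih =>
    have hk := key m
    rw [Finset.Nat.sum_antidiagonal_eq_sum_range_succ_mk, Finset.sum_range_succ'] at hk
    rw [Finset.sum_eq_zero] at hk
    · simp only [Nat.sub_zero, zero_add] at hk
      linear_combination 2 * hk - (d (d (d (r m))) + 4 * u * d (r m)
        + 2 * d u * r m - d (r (m + 1))) * h0
    · intro k hkm
      rw [Finset.mem_range] at hkm
      simp only
      rw [ih (m - (k + 1)) (by omega), mul_zero]

theorem d_resolventB (d : Derivation ℝ A A) (u : A) (k l : ℕ) :
    d (resolventB d u k l) = d (resolventCoeff d u k) * resolventCoeff d u l := by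
  induction k generalizing l with
  | zero => simp [resolventB, d_resolventCoeff_zero]
  | succ k ih =>
    have h4 : d (4 : A) = 0 := by
      have h : (4 : A) = algebraMap ℝ A 4 := (map_ofNat (algebraMap ℝ A) 4).symm
      rw [h]; exact d.map_algebraMap _
    rw [resolventB]
    simp only [map_add, map_sub, Derivation.leibniz, smul_eq_mul, ih, h4, mul_zero, add_zero]
    linear_combination resolventCoeff d u l * resolvent_linear d u k
      + resolventCoeff d u k * resolvent_linear d u l

theorem resolventCoeff_no_const (d : Derivation ℝ A A) (u : A) (ε : A →ₐ[ℝ] ℝ)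
    (hd : ∀ f, ε (d f) = 0) (hu : ε u = 0) (m : ℕ) : ε (resolventCoeff d u (m + 1)) = 0 := by
  induction m using Nat.strong_induction_on with
  | _ m ih =>
    rw [resolventCoeff]
    simp only [map_sub, map_mul, map_sum, map_add, map_smul, hd, hu]
    rw [Finset.sum_eq_zero, Finset.sum_eq_zero]
    · simp
    · intro k _
      rw [ih k k.2, zero_mul]
    · intro k _
      simp

theorem resolventB_no_const (d : Derivation ℝ A A) (u : A) (ε : A →ₐ[ℝ] ℝ)
    (hd : ∀ f, ε (d f) = 0) (hu : ε u = 0) (k l : ℕ) : ε (resolventB d u k l) = 0 := by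
  induction k generalizing l with
  | zero => simp [resolventB]
  | succ k ih =>
    rw [resolventB]
    simp [hd, hu, ih, resolventCoeff_no_const d u ε hd hu l]

end Resolvent

/-! ### Differential polynomials in one field `v` of the multi-time variables `t_1, ..., t_N`

The coordinates are indexed by `Fin N`: the index `i` stands for `t_(i+1)`, and the index `0` for
`t_1 = x`. -/

/-- Differential polynomials: real polynomials in the jet variables `v_I`, `I` a multi-index. -/
abbrev DiffPoly (N : ℕ) := MvPolynomial (Fin N →₀ ℕ) ℝ

/-- The jet variable `v_I`. -/
abbrev jetVar {N : ℕ} (I : Fin N →₀ ℕ) : DiffPoly N := MvPolynomial.X I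

/-- The multi-index consisting of `α` times the index `i`. -/
abbrev idx {N : ℕ} (i : Fin N) (α : ℕ) : Fin N →₀ ℕ := Finsupp.single i α

/-- The total derivative `D_i = ∑_I v_(Ii) ∂/∂v_I`. -/
def totalDeriv {N : ℕ} (i : Fin N) : Derivation ℝ (DiffPoly N) (DiffPoly N) :=
  MvPolynomial.mkDerivation ℝ (fun I => jetVar (I + idx i 1))

/-- The variational derivative in one coordinate direction (a sum with finitely many non-zero
terms), `∑_α (-1)^α D_i^α ∂P/∂v_(I i^α)`. -/
def varDeriv₁ {N : ℕ} (i : Fin N) (P : DiffPoly N) (I : Fin N →₀ ℕ) : DiffPoly N :=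
  ∑ᶠ α : ℕ, (-1) ^ α * (totalDeriv i)^[α] (MvPolynomial.pderiv (I + idx i α) P)

/-- The variational derivative in two coordinate directions (a sum with finitely many non-zero
terms), `∑_(α,β) (-1)^(α+β) D_i^α D_j^β ∂P/∂v_(I i^α j^β)`. -/
def varDeriv₂ {N : ℕ} (i j : Fin N) (P : DiffPoly N) (I : Fin N →₀ ℕ) : DiffPoly N :=
  ∑ᶠ p : ℕ × ℕ, (-1) ^ (p.1 + p.2) * (totalDeriv i)^[p.1] ((totalDeriv j)^[p.2]
    (MvPolynomial.pderiv (I + idx i p.1 + idx j p.2) P))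

/-- The left-hand sides of the multi-time Euler-Lagrange equations of a Lagrangian two-form
`∑_(i<j) L_(ij) dt_i ∧ dt_j`, where `L_(ji) = - L_(ij)`:
* `δ_(ij) L_(ij) / δv_I = 0` for `I` not containing `i, j`;
* `δ_(ij) L_(ij) / δv_(Ij) = δ_(ik) L_(ik) / δv_(Ik)` for `I` not containing `i`;
* `δ_(ij) L_(ij) / δv_(Iij) + δ_(jk) L_(jk) / δv_(Ijk) + δ_(ki) L_(ki) / δv_(Iki) = 0` for all `I`,
where `i, j, k` are distinct. -/
def multiTimeEL {N : ℕ} (L : Fin N → Fin N → DiffPoly N) : Set (DiffPoly N) :=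
  {P | ∃ i j I, i ≠ j ∧ I i = 0 ∧ I j = 0 ∧ P = varDeriv₂ i j (L i j) I} ∪
  {P | ∃ i j k I, i ≠ j ∧ i ≠ k ∧ j ≠ k ∧ I i = 0 ∧
    P = varDeriv₂ i j (L i j) (I + idx j 1) - varDeriv₂ i k (L i k) (I + idx k 1)} ∪
  {P | ∃ i j k I, i ≠ j ∧ i ≠ k ∧ j ≠ k ∧
    P = varDeriv₂ i j (L i j) (I + idx i 1 + idx j 1)
      + varDeriv₂ j k (L j k) (I + idx j 1 + idx k 1)
      + varDeriv₂ k i (L k i) (I + idx k 1 + idx i 1)}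

/-- The differential ideal generated by a set `S` of differential polynomials: the smallest ideal
that contains `S` and is closed under all total derivatives. -/
def differentialIdeal {N : ℕ} (S : Set (DiffPoly N)) : Ideal (DiffPoly N) :=
  sInf {J | S ⊆ J ∧ ∀ i, ∀ f ∈ J, totalDeriv i f ∈ J}

/-! ### The potential KdV hierarchy and its Lagrangian two-form -/

section KdV

variable (N : ℕ) [NeZero N]

/-- `g_k[v] = r_k[v_x]`. -/
def kdvG (k : ℕ) : DiffPoly N := resolventCoeff (totalDeriv 0) (jetVar (idx 0 1)) k

/-- `h_k = g_(k+1) / (4k+2)`. -/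
def kdvH (k : ℕ) : DiffPoly N := (1 / (4 * (k : ℝ) + 2)) • kdvG N (k + 1)

/-- `b_(kl)`, determined by `D_x (b_(kl)) = D_x (g_k) g_l` and the absence of a constant term. -/
def kdvB (k l : ℕ) : DiffPoly N := resolventB (totalDeriv 0) (jetVar (idx 0 1)) k l

theorem totalDeriv_kdvB (k l : ℕ) :
    totalDeriv 0 (kdvB N k l) = totalDeriv 0 (kdvG N k) * kdvG N l :=
  d_resolventB _ _ _ _

theorem kdvB_no_const (k l : ℕ) : MvPolynomial.aeval (fun _ => (0 : ℝ)) (kdvB N k l) = 0 := by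
  apply resolventB_no_const
  · intro f
    induction f using MvPolynomial.induction_on with
    | C a => simp [totalDeriv]
    | add p q hp hq => rw [map_add, map_add, hp, hq, add_zero]
    | mul_X p I _ => simp [totalDeriv, MvPolynomial.mkDerivation_X]
  · simp

/-- For the coordinates `i, j` (that is, the times number `i+1` and `j+1`), the differential
polynomial `v_(t_j) δ_1 h_i/δv_x + v_(x t_j) δ_1 h_i/δv_xx + v_(xx t_j) δ_1 h_i/δv_xxx + ...` (a sum
with finitely many non-zero terms). -/
def kdvA (i j : Fin N) : DiffPoly N :=
  ∑ᶠ α : ℕ, jetVar (idx 0 α + idx j 1) * varDeriv₁ 0 (kdvH N (i + 1)) (idx 0 (α + 1))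

/-- The coefficients `L_(ij)` with `i < j` of the Lagrangian two-form. -/
def kdvLagrangianAux (i j : Fin N) : DiffPoly N :=
  if i = 0 then
    (1 / 2 : ℝ) • (jetVar (idx 0 1) * jetVar (idx j 1)) - kdvH N (j + 1)
  else
    (1 / 2 : ℝ) • (jetVar (idx i 1) * kdvG N (j + 1) - jetVar (idx j 1) * kdvG N (i + 1))
      + (kdvA N i j - kdvA N j i)
      - (1 / 2 : ℝ) • (kdvB N (i + 1) (j + 1) - kdvB N (j + 1) (i + 1))

/-- The coefficients of the Lagrangian two-form of the PKdV hierarchy, with `L_(ji) = - L_(ij)`. -/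
def kdvLagrangian (i j : Fin N) : DiffPoly N :=
  if i < j then kdvLagrangianAux N i j
  else if j < i then - kdvLagrangianAux N j i
  else 0

/-- The differential polynomial `v_(t_k) - g_k`, for the time number `k+1`. -/
def pkdv (k : Fin N) : DiffPoly N := jetVar (idx k 1) - kdvG N (k + 1)

/-- The non-trivial PKdV equations `v_(t_2) = g_2, ..., v_(t_N) = g_N`. -/
def pkdvSystem : Set (DiffPoly N) := {P | ∃ k : Fin N, k ≠ 0 ∧ P = pkdv N k}

end KdV

/-! ### Fields on multi-time and critical points of the action -/

section Analysis

variable {N : ℕ}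

/-- The partial derivative in the direction `t_i`. -/
def partialDeriv (i : Fin N) (f : (Fin N → ℝ) → ℝ) : (Fin N → ℝ) → ℝ :=
  fun t => fderiv ℝ f t (Pi.single i 1)

/-- The partial derivative `f_I = ∂_1^(I_1) ... ∂_N^(I_N) f`. -/
def mixedPartial (I : Fin N →₀ ℕ) (f : (Fin N → ℝ) → ℝ) : (Fin N → ℝ) → ℝ :=
  (List.finRange N).foldr (fun i F => (partialDeriv i)^[I i] F) f

/-- The value at `t` of the differential polynomial `P` on the field `v`. -/
def evalOn (v : (Fin N → ℝ) → ℝ) (t : Fin N → ℝ) (P : DiffPoly N) : ℝ :=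
  MvPolynomial.eval (fun I => mixedPartial I v t) P

/-- The field `v` satisfies all equations `P = 0` with `P ∈ S`. -/
def IsSolution (S : Set (DiffPoly N)) (v : (Fin N → ℝ) → ℝ) : Prop :=
  ∀ P ∈ S, ∀ t, evalOn v t P = 0

/-- The contraction of `δP = ∑_I ∂P/∂v_I δv_I` with the prolongation of the variation `w`, evaluated
on the field `v`. -/
def firstVariation (P : DiffPoly N) (v w : (Fin N → ℝ) → ℝ) (t : Fin N → ℝ) : ℝ :=
  ∑ I ∈ P.vars, evalOn v t (MvPolynomial.pderiv I P) * mixedPartial I w t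

/-- `σ` parametrizes a smooth embedded compact surface patch in multi-time by the unit square. -/
def IsSurfacePatch (σ : ℝ × ℝ → Fin N → ℝ) : Prop :=
  ContDiff ℝ ∞ σ ∧ Set.InjOn σ (Set.Icc 0 1) ∧
    ∀ s ∈ Set.Icc (0 : ℝ × ℝ) 1, Function.Injective (fderiv ℝ σ s)

/-- The integral, over the surface `S` parametrized by `σ` on the unit square, of the contraction of
`δL` with the prolongation of `w`, where `L = ∑_(i<j) L_(ij) dt_i ∧ dt_j`. -/
def actionVariation (L : Fin N → Fin N → DiffPoly N) (v w : (Fin N → ℝ) → ℝ)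
    (σ : ℝ × ℝ → Fin N → ℝ) : ℝ :=
  ∫ s in Set.Icc (0 : ℝ × ℝ) 1,
    ∑ p ∈ Finset.univ.filter (fun p : Fin N × Fin N => p.1 < p.2),
      firstVariation (L p.1 p.2) v w (σ s) *
        (fderiv ℝ σ s (1, 0) p.1 * fderiv ℝ σ s (0, 1) p.2
          - fderiv ℝ σ s (0, 1) p.1 * fderiv ℝ σ s (1, 0) p.2)

/-- The field `v` solves the pluri-Lagrangian problem for the two-form `L`: it is a critical point of
the action on every smooth surface, with respect to all smooth variations that vanish near the
boundary of the surface. (By a partition of unity subordinate to patches, surfaces of any other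
topology give no further condition.) -/
def SolvesPluriLagrangian (L : Fin N → Fin N → DiffPoly N) (v : (Fin N → ℝ) → ℝ) : Prop :=
  ∀ σ, IsSurfacePatch σ → ∀ w : (Fin N → ℝ) → ℝ, ContDiff ℝ ∞ w →
    (∀ s ∈ frontier (Set.Icc (0 : ℝ × ℝ) 1), σ s ∉ tsupport w) → actionVariation L v w σ = 0

end Analysis

end PluriLagrangian

end

open PluriLagrangian

/-! Write E_k = v_{t_k} - g_k. Everything rests on the exterior derivative of the Lagrangian. The
variational identity δ_1 h_k/δv_x = g_k, together with the definitions of a_ij and b_ij, makes the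
coefficient of dx ∧ dt_i ∧ dt_j in dL equal to ½(E_i D_x E_j - E_j D_x E_i)
(`extCoeff_kdvLagrangian_zero`). This is quadratic in the equations, so all its partial derivatives
lie in the differential ideal of the E_k. The coefficients without dx inherit this from d(dL) = 0
(`pderiv_extCoeff_mem`). The identity for h_k comes from the resolvent: by
`resolventCoeff_variation`, any derivation commuting with d sends r_{k+1} to (4k+2) r_k times the
image of u, up to the image of d.

An alternating sum over the three directions i, j, k turns the partial derivatives of the
coefficient (dL)_ijk into a cyclic sum of shifted variational derivatives of L
(`shiftDown_varDeriv₂_mem`). According to which of i, j, k occur in the multi-index, this sum is the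
defect of one of the three families of multi-time Euler–Lagrange equations, so all of them lie in
the ideal. Conversely, comparing δ_kj L_kj/δv_{t_j} = ½ g_k with δ_k1 L_k1/δv_x = g_k - ½ v_{t_k}
gives ½ E_k.

Criticality of the action is compared with the PKdV equations directly, without a general
equivalence between criticality and the multi-time equations. If the E_k vanish, then δL = dθ for an
explicit one-form θ that depends linearly and locally on the variation w (`defectForm_eq_zero`), and
Stokes' theorem gives criticality. The components of δL - dθ without dx need no computation: they
are constant along x, and cutting off w makes them vanish far away.

In the other direction, the test surfaces are planes spanned by ∂_{t_j} + r ∂_x and ∂_{t_k}, with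
variations that vanish on the plane but have a prescribed x-derivative there. Up to an exact form
the first variation is this derivative times X + (r/2) E_k, where X does not involve the slope r
(`exists_variation_plane`). The fundamental lemma makes this factor zero for every r, hence E_k = 0.
-/

noncomputable section

namespace PluriLagrangian

/-! ### Variation of the resolvent coefficients -/

section ResolventVariation

variable {A : Type*} [CommRing A] [Algebra ℝ A]

/-- The coefficientwise extension of a derivation to power series. -/
def coeffDeriv (d : Derivation ℝ A A) : Derivation ℝ (PowerSeries A) (PowerSeries A) :=
  Derivation.mk'
    { toFun := fun f => PowerSeries.mk fun n => d (PowerSeries.coeff n f)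
      map_add' := fun f g => by ext n; simp
      map_smul' := fun c f => by
        ext n
        simp }
    (fun f g => by
      ext n
      simp only [LinearMap.coe_mk, AddHom.coe_mk, PowerSeries.coeff_mk, smul_eq_mul, map_add,
        PowerSeries.coeff_mul, map_sum, Derivation.leibniz, Finset.sum_add_distrib]
      congr 1
      rw [← Finset.Nat.sum_antidiagonal_swap]
      rfl)

@[simp]
theorem coeff_coeffDeriv (d : Derivation ℝ A A) (f : PowerSeries A) (n : ℕ) :
    PowerSeries.coeff n (coeffDeriv d f) = d (PowerSeries.coeff n f) := by
  simp [coeffDeriv]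

@[simp]
theorem coeffDeriv_X (d : Derivation ℝ A A) : coeffDeriv d PowerSeries.X = 0 := by
  ext n
  rw [coeff_coeffDeriv, PowerSeries.coeff_X]
  split_ifs <;> simp

theorem coeffDeriv_C (d : Derivation ℝ A A) (a : A) :
    coeffDeriv d (PowerSeries.C a) = PowerSeries.C (d a) := by
  ext n
  rw [coeff_coeffDeriv, PowerSeries.coeff_C, PowerSeries.coeff_C]
  split_ifs <;> simp

theorem coeffDeriv_comm {d e : Derivation ℝ A A} (h : ∀ a, d (e a) = e (d a))
    (f : PowerSeries A) : coeffDeriv d (coeffDeriv e f) = coeffDeriv e (coeffDeriv d f) := by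
  ext n
  simp [h]

/-- The quadratic equation for the resolvent, as an identity of power series in `X = z^(-2)`. -/
theorem resolventSeries_quadratic (d : Derivation ℝ A A) (u : A) (R : PowerSeries A)
    (hR : R = PowerSeries.mk (resolventCoeff d u)) :
    4 * PowerSeries.X * (2 * R * coeffDeriv d (coeffDeriv d R) - coeffDeriv d R ^ 2
      + 4 * PowerSeries.C u * R ^ 2) = 4 * R ^ 2 - 1 := by
  have h2 : ∀ x : A, 2 * ((1 / 2 : ℝ) • x) = x := fun x => by
    have : (2 : A) * ((1 / 2 : ℝ) • x) = (2 : ℝ) • ((1 / 2 : ℝ) • x) := by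
      rw [Algebra.smul_def (2 : ℝ), map_ofNat]
    rw [this, smul_smul]; norm_num
  ext n
  cases n with
  | zero =>
    have h0 := two_mul_resolventCoeff_zero d u
    have : PowerSeries.constantCoeff R = resolventCoeff d u 0 := by
      rw [hR, ← PowerSeries.coeff_zero_eq_constantCoeff_apply, PowerSeries.coeff_mk]
    simp only [PowerSeries.coeff_zero_eq_constantCoeff, map_mul, map_sub, map_pow, this,
      PowerSeries.constantCoeff_X, map_one, map_ofNat]
    linear_combination (-(2 * resolventCoeff d u 0) - 1) * h0
  | succ m =>
    -- The factor X lowers the index by one, so the coefficient of X^(m+1) is eight times the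
    -- quadratic relation at m.
    have hq := resolvent_quadratic d u m
    rw [mul_right_comm, PowerSeries.coeff_succ_mul_X, map_sub]
    have e4 : ∀ k (f : PowerSeries A), PowerSeries.coeff k (4 * f)
        = 4 * PowerSeries.coeff k f := fun k f => by
      rw [← map_ofNat (PowerSeries.C (R := A)) 4, PowerSeries.coeff_C_mul]
    have e2 : ∀ k (f : PowerSeries A), PowerSeries.coeff k (2 * f)
        = 2 * PowerSeries.coeff k f := fun k f => by
      rw [← map_ofNat (PowerSeries.C (R := A)) 2, PowerSeries.coeff_C_mul]
    rw [e4, e4, PowerSeries.coeff_one, if_neg (Nat.succ_ne_zero m), map_add, map_sub, mul_assoc,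
      e2, mul_assoc, e4, PowerSeries.coeff_C_mul, pow_two, pow_two]
    simp only [PowerSeries.coeff_mul, coeff_coeffDeriv, hR, PowerSeries.coeff_mk]
    simp only [Finset.sum_add_distrib, Finset.sum_sub_distrib, ← Finset.smul_sum] at hq
    have e5 : ∑ x ∈ Finset.HasAntidiagonal.antidiagonal m,
        2 * u * resolventCoeff d u x.1 * resolventCoeff d u x.2
      = 2 * (u * ∑ x ∈ Finset.HasAntidiagonal.antidiagonal m,
          resolventCoeff d u x.1 * resolventCoeff d u x.2) := by
      simp only [Finset.mul_sum, mul_assoc]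
    rw [e5] at hq
    linear_combination 8 * hq
      + 4 * h2 (∑ p ∈ Finset.HasAntidiagonal.antidiagonal m,
          d (resolventCoeff d u p.1) * d (resolventCoeff d u p.2))
      + 4 * h2 (∑ p ∈ Finset.HasAntidiagonal.antidiagonal (m + 1),
          resolventCoeff d u p.1 * resolventCoeff d u p.2)

/-- The Euler derivation `X d/dX` of power series. -/
def eulerDeriv (A : Type*) [CommRing A] : Derivation A (PowerSeries A) (PowerSeries A) :=
  (PowerSeries.X : PowerSeries A) • PowerSeries.derivative A

theorem coeff_eulerDeriv {A : Type*} [CommRing A] (f : PowerSeries A) (n : ℕ) :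
    PowerSeries.coeff n (eulerDeriv A f) = n * PowerSeries.coeff n f := by
  rw [eulerDeriv, Derivation.smul_apply, smul_eq_mul]
  cases n with
  | zero => simp
  | succ n =>
    rw [PowerSeries.coeff_succ_X_mul, PowerSeries.coeff_derivative]
    push_cast
    ring

theorem eulerDeriv_coeffDeriv (d : Derivation ℝ A A) (f : PowerSeries A) :
    eulerDeriv A (coeffDeriv d f) = coeffDeriv d (eulerDeriv A f) := by
  ext n
  simp [coeff_eulerDeriv]

/-- A derivation that commutes with `d` maps `r_(k+1)` to `(4k+2) r_k` times the image of `u`, up to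
the image of `d`. -/
theorem resolventCoeff_variation (d e : Derivation ℝ A A) (h : ∀ a, d (e a) = e (d a)) (u : A)
    (k : ℕ) : ∃ s : A, e (resolventCoeff d u (k + 1))
      = (4 * (k : A) + 2) * (resolventCoeff d u k * e u) + d s := by
  set R := PowerSeries.mk (resolventCoeff d u) with hR
  have hq := resolventSeries_quadratic d u R hR
  obtain ⟨Q, hQ⟩ : ∃ Q, R * Q = 1 := by
    have : IsUnit R := by
      rw [PowerSeries.isUnit_iff_constantCoeff, hR,
        ← PowerSeries.coeff_zero_eq_constantCoeff_apply, PowerSeries.coeff_mk]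
      exact IsUnit.of_mul_eq_one 2 (by rw [mul_comm]; exact two_mul_resolventCoeff_zero d u)
    exact this.exists_right_inv
  have e2 : ∀ d : Derivation ℝ A A, coeffDeriv d 2 = 0 := fun d => (coeffDeriv d).map_natCast 2
  have e4 : ∀ d : Derivation ℝ A A, coeffDeriv d 4 = 0 := fun d => (coeffDeriv d).map_natCast 4
  have E2 : eulerDeriv A 2 = 0 := (eulerDeriv A).map_natCast 2
  have E4 : eulerDeriv A 4 = 0 := (eulerDeriv A).map_natCast 4
  have EX : eulerDeriv A PowerSeries.X = PowerSeries.X := by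
    simp [eulerDeriv]
  have EC : eulerDeriv A (PowerSeries.C u) = 0 := by
    simp [eulerDeriv]
  have hδ := congrArg (coeffDeriv e) hq
  have hE := congrArg (eulerDeriv A) hq
  have hdQ := congrArg (coeffDeriv d) hQ
  simp only [map_add, map_sub, Derivation.leibniz, Derivation.leibniz_pow, smul_eq_mul, e2, e4, E2,
    E4, EX, EC, coeffDeriv_X, coeffDeriv_C, eulerDeriv_coeffDeriv, Derivation.map_one_eq_zero,
    mul_zero, add_zero, sub_zero, nsmul_eq_mul, Nat.cast_ofNat, Nat.add_one_sub_one,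
    pow_one, ← coeffDeriv_comm h] at hδ hE hdQ
  -- Let ℓ be the quadratic equation linearized at R. Then ℓ(eR) = -16 X e(u) R². Neither R nor its
  -- Euler derivative is mapped to a multiple of R² alone, but in this combination the terms with
  -- the factor X cancel and ℓ(T) = -8 R².
  set T : PowerSeries A := 2 * eulerDeriv A R + R with hT
  have hdT : coeffDeriv d T = 2 * coeffDeriv d (eulerDeriv A R) + coeffDeriv d R := by
    rw [hT, map_add, Derivation.leibniz, e2]; simp
  have hddT : coeffDeriv d (coeffDeriv d T)
      = 2 * coeffDeriv d (coeffDeriv d (eulerDeriv A R)) + coeffDeriv d (coeffDeriv d R) := by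
    rw [hdT, map_add, Derivation.leibniz, e2]; simp
  -- Wronskian of the two arguments of ℓ: in T ℓ(eR) - eR ℓ(T) only 8X(R W' - R' W) = 8X R² (W/R)'
  -- survives on the left.
  set W : PowerSeries A := T * coeffDeriv d (coeffDeriv e R) - coeffDeriv e R * coeffDeriv d T
    with hW
  have hdW : coeffDeriv d W = T * coeffDeriv d (coeffDeriv d (coeffDeriv e R))
      - coeffDeriv e R * coeffDeriv d (coeffDeriv d T) := by
    rw [hW, map_sub, Derivation.leibniz, Derivation.leibniz]
    simp only [smul_eq_mul]
    ring
  have key : coeffDeriv e R = PowerSeries.X * (coeffDeriv d (W * Q)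
      + PowerSeries.C 2 * T * PowerSeries.C (e u)) := by
    have h8 : (8 : PowerSeries A) * algebraMap ℝ _ (1 / 8) = 1 := by
      rw [← map_ofNat (algebraMap ℝ (PowerSeries A)) 8, ← map_mul]
      norm_num
    -- The elimination above, with Q = 1/R; the factor 8R² is a unit and is divided out afterwards.
    have hmain : 8 * R ^ 2 * (coeffDeriv e R - PowerSeries.X * (coeffDeriv d (W * Q)
        + 2 * T * PowerSeries.C (e u))) = 0 := by
      rw [Derivation.leibniz, smul_eq_mul, smul_eq_mul]
      linear_combination (-T) * hδ + 2 * coeffDeriv e R * hE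
        - 8 * PowerSeries.X * R * W * hdQ
        + 8 * PowerSeries.X * (W * coeffDeriv d R - R * coeffDeriv d W) * hQ
        - 8 * PowerSeries.X * R * hdW
        + 8 * PowerSeries.X * R * coeffDeriv e R * hddT
        - 8 * PowerSeries.X * coeffDeriv d R * coeffDeriv e R * hdT
        + 8 * PowerSeries.X * coeffDeriv d R * hW
    rw [map_ofNat, ← sub_eq_zero]
    generalize coeffDeriv e R - PowerSeries.X * (coeffDeriv d (W * Q)
        + 2 * T * PowerSeries.C (e u)) = Y at hmain
    linear_combination algebraMap ℝ (PowerSeries A) (1 / 8) * Q ^ 2 * hmain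
      - (R * Q + 1) * Y * hQ - (R * Q) ^ 2 * Y * h8
  -- The Euler derivation multiplies the k-th coefficient by k; this is the origin of the factor
  -- 4k+2.
  have hTk : PowerSeries.coeff k T = (2 * k + 1) * resolventCoeff d u k := by
    have c2 : (2 : PowerSeries A) = PowerSeries.C 2 := (map_ofNat _ 2).symm
    rw [hT, c2, map_add, PowerSeries.coeff_C_mul, coeff_eulerDeriv, hR, PowerSeries.coeff_mk]
    ring
  have hk := congrArg (PowerSeries.coeff (k + 1)) key
  rw [PowerSeries.coeff_succ_X_mul, map_add, coeff_coeffDeriv, coeff_coeffDeriv,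
    PowerSeries.coeff_mul_C, PowerSeries.coeff_C_mul, hTk, hR, PowerSeries.coeff_mk] at hk
  exact ⟨PowerSeries.coeff k (W * Q), by rw [hk]; ring⟩

end ResolventVariation

/-! ### Total derivatives and variational derivatives -/

section Variational

variable {N : ℕ}

@[simp]
theorem totalDeriv_X (i : Fin N) (I : Fin N →₀ ℕ) :
    totalDeriv i (MvPolynomial.X I) = MvPolynomial.X (I + idx i 1) := by
  simp [totalDeriv, MvPolynomial.mkDerivation_X]

@[simp]
theorem totalDeriv_C (i : Fin N) (c : ℝ) : totalDeriv i (MvPolynomial.C c) = 0 := by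
  simp [totalDeriv]

theorem totalDeriv_comm (i j : Fin N) (P : DiffPoly N) :
    totalDeriv i (totalDeriv j P) = totalDeriv j (totalDeriv i P) := by
  induction P using MvPolynomial.induction_on with
  | C a => simp
  | add p q hp hq => simp [hp, hq]
  | mul_X p I hp =>
    simp only [Derivation.leibniz, map_add, totalDeriv_X, smul_eq_mul, hp]
    rw [add_right_comm I (idx j 1) (idx i 1)]
    ring

theorem totalDeriv_iterate_comm (i j : Fin N) (n : ℕ) (P : DiffPoly N) :
    (totalDeriv i)^[n] (totalDeriv j P) = totalDeriv j ((totalDeriv i)^[n] P) :=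
  (Function.Commute.iterate_left (f := totalDeriv i) (g := totalDeriv j)
    (fun P => totalDeriv_comm i j P) n).eq P

theorem totalDeriv_iterate_comm_iterate (i j : Fin N) (m n : ℕ) (P : DiffPoly N) :
    (totalDeriv i)^[m] ((totalDeriv j)^[n] P) = (totalDeriv j)^[n] ((totalDeriv i)^[m] P) :=
  (Function.Commute.iterate_iterate (f := totalDeriv i) (g := totalDeriv j)
    (fun P => totalDeriv_comm i j P) m n).eq P

theorem totalDeriv_iterate_eq_pow (i : Fin N) (n : ℕ) (P : DiffPoly N) :
    (totalDeriv i)^[n] P = ((totalDeriv i : DiffPoly N →ₗ[ℝ] DiffPoly N) ^ n) P := by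
  rw [Module.End.pow_apply]
  rfl

theorem totalDeriv_iterate_zero (i : Fin N) (n : ℕ) : (totalDeriv i)^[n] 0 = 0 := by
  rw [totalDeriv_iterate_eq_pow, map_zero]

theorem totalDeriv_iterate_add (i : Fin N) (n : ℕ) (P Q : DiffPoly N) :
    (totalDeriv i)^[n] (P + Q) = (totalDeriv i)^[n] P + (totalDeriv i)^[n] Q := by
  simp only [totalDeriv_iterate_eq_pow, map_add]

theorem totalDeriv_iterate_sum {ι : Type*} (i : Fin N) (n : ℕ) (s : Finset ι)
    (f : ι → DiffPoly N) :
    (totalDeriv i)^[n] (∑ a ∈ s, f a) = ∑ a ∈ s, (totalDeriv i)^[n] (f a) := by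
  simp only [totalDeriv_iterate_eq_pow, map_sum]

theorem neg_one_pow_mul_eq_smul (n : ℕ) (P : DiffPoly N) :
    (-1) ^ n * P = ((-1 : ℝ) ^ n) • P := by
  rw [MvPolynomial.smul_eq_C_mul]
  simp

theorem totalDeriv_iterate_neg_one_pow_mul (i : Fin N) (n m : ℕ) (P : DiffPoly N) :
    (totalDeriv i)^[n] ((-1) ^ m * P) = (-1) ^ m * (totalDeriv i)^[n] P := by
  simp only [totalDeriv_iterate_eq_pow, neg_one_pow_mul_eq_smul, map_smul]

theorem totalDeriv_neg_one_pow_mul (i : Fin N) (m : ℕ) (P : DiffPoly N) :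
    totalDeriv i ((-1) ^ m * P) = (-1) ^ m * totalDeriv i P :=
  totalDeriv_iterate_neg_one_pow_mul i 1 m P

/-- The family `J ↦ F (J - i)`, zero where `J` does not contain `i`. -/
def shiftDown (i : Fin N) (F : (Fin N →₀ ℕ) → DiffPoly N) (J : Fin N →₀ ℕ) : DiffPoly N :=
  if J i = 0 then 0 else F (J - idx i 1)

theorem sub_idx_add_idx {i : Fin N} {J : Fin N →₀ ℕ} (h : J i ≠ 0) :
    J - idx i 1 + idx i 1 = J := by
  apply tsub_add_cancel_of_le
  rw [Finsupp.single_le_iff]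
  omega

theorem shiftDown_add_idx (i : Fin N) (F : (Fin N →₀ ℕ) → DiffPoly N) (J : Fin N →₀ ℕ) :
    shiftDown i F (J + idx i 1) = F J := by
  simp [shiftDown]

/-- The commutator of ∂/∂v_J with D_i is ∂/∂v_(J-i), because D_i contains the term v_J ∂/∂v_(J-i).
It vanishes on constants and needs checking only on jet variables. -/
theorem pderiv_totalDeriv (i : Fin N) (J : Fin N →₀ ℕ) (P : DiffPoly N) :
    MvPolynomial.pderiv J (totalDeriv i P) = totalDeriv i (MvPolynomial.pderiv J P)
      + shiftDown i (fun J => MvPolynomial.pderiv J P) J := by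
  induction P using MvPolynomial.induction_on with
  | C a => simp [shiftDown]
  | add p q hp hq =>
    simp only [map_add, hp, hq, shiftDown]
    split_ifs <;> ring
  | mul_X p I hp =>
    have hX : MvPolynomial.pderiv J (MvPolynomial.X (I + idx i 1))
        = shiftDown i (fun J => MvPolynomial.pderiv J (MvPolynomial.X I : DiffPoly N)) J := by
      rw [shiftDown]
      split_ifs with h
      · rw [MvPolynomial.pderiv_X_of_ne]
        rintro rfl
        simp at h
      · by_cases hI : I = J - idx i 1
        · rw [hI, sub_idx_add_idx h, MvPolynomial.pderiv_X_self, MvPolynomial.pderiv_X_self]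
        · rw [MvPolynomial.pderiv_X_of_ne hI, MvPolynomial.pderiv_X_of_ne]
          rintro rfl
          simp at hI
    have hD : totalDeriv i (MvPolynomial.pderiv J (MvPolynomial.X I : DiffPoly N)) = 0 := by
      by_cases hI : I = J
      · rw [hI, MvPolynomial.pderiv_X_self]
        simp
      · rw [MvPolynomial.pderiv_X_of_ne hI, map_zero]
    simp only [Derivation.leibniz, map_add, totalDeriv_X, smul_eq_mul, hp, hX, hD]
    simp only [shiftDown]
    split_ifs <;> ring

/-- A family of differential polynomials that vanishes at all multi-indices of degree at least
`M`. -/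
def VanishesFrom (M : ℕ) (F : (Fin N →₀ ℕ) → DiffPoly N) : Prop :=
  ∀ J : Fin N →₀ ℕ, M ≤ J.degree → F J = 0

theorem VanishesFrom.mono {M M' : ℕ} {F : (Fin N →₀ ℕ) → DiffPoly N} (h : VanishesFrom M F)
    (hM : M ≤ M') : VanishesFrom M' F := fun J hJ => h J (hM.trans hJ)

theorem exists_vanishesFrom (P : DiffPoly N) :
    ∃ M, VanishesFrom M (fun J => MvPolynomial.pderiv J P) := by
  refine ⟨P.vars.sup Finsupp.degree + 1, fun J hJ => ?_⟩
  apply MvPolynomial.pderiv_eq_zero_of_notMem_vars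
  intro h
  have := Finset.le_sup (f := Finsupp.degree) h
  omega

/-- The alternating sum `∑_(α < M) (-1)^α D_i^α F(J i^α)`. -/
def altSum (i : Fin N) (M : ℕ) (F : (Fin N →₀ ℕ) → DiffPoly N) (J : Fin N →₀ ℕ) : DiffPoly N :=
  ∑ α ∈ Finset.range M, (-1) ^ α * (totalDeriv i)^[α] (F (J + idx i α))

theorem altSum_add (i : Fin N) (M : ℕ) (F G : (Fin N →₀ ℕ) → DiffPoly N) :
    altSum i M (F + G) = altSum i M F + altSum i M G := by
  funext J
  simp only [altSum, Pi.add_apply, totalDeriv_iterate_add, mul_add, Finset.sum_add_distrib]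

theorem altSum_comm (i j : Fin N) (M M' : ℕ) (F : (Fin N →₀ ℕ) → DiffPoly N) :
    altSum i M (altSum j M' F) = altSum j M' (altSum i M F) := by
  funext J
  simp only [altSum, totalDeriv_iterate_sum, totalDeriv_iterate_neg_one_pow_mul, Finset.mul_sum]
  rw [Finset.sum_comm]
  refine Finset.sum_congr rfl fun β _ => Finset.sum_congr rfl fun α _ => ?_
  rw [totalDeriv_iterate_comm_iterate, add_right_comm]
  ring

theorem altSum_totalDeriv (i j : Fin N) (M : ℕ) (F : (Fin N →₀ ℕ) → DiffPoly N) :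
    altSum i M (fun J => totalDeriv j (F J)) = fun J => totalDeriv j (altSum i M F J) := by
  funext J
  simp only [altSum, totalDeriv_iterate_comm, map_sum, totalDeriv_neg_one_pow_mul]

theorem altSum_shiftDown {i j : Fin N} (h : i ≠ j) (M : ℕ) (F : (Fin N →₀ ℕ) → DiffPoly N) :
    altSum i M (shiftDown j F) = shiftDown j (altSum i M F) := by
  funext J
  have hJ : ∀ α, (J + idx i α) j = J j := fun α => by simp [h]
  simp only [altSum, shiftDown, hJ]
  split_ifs with h0
  · simp
  · refine Finset.sum_congr rfl fun α _ => ?_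
    rw [tsub_add_eq_add_tsub]
    rw [Finsupp.single_le_iff]
    omega

theorem VanishesFrom.altSum {M : ℕ} {F : (Fin N →₀ ℕ) → DiffPoly N} (h : VanishesFrom M F)
    (i : Fin N) (M' : ℕ) : VanishesFrom M (altSum i M' F) := by
  intro J hJ
  refine Finset.sum_eq_zero fun α _ => ?_
  rw [h, totalDeriv_iterate_zero, mul_zero]
  rw [map_add]
  omega

/-- The shifted part of the summand α+1 cancels the differentiated part of the summand α, so only
the two ends remain. -/
theorem altSum_succ_telescope (i : Fin N) (M : ℕ) (F : (Fin N →₀ ℕ) → DiffPoly N)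
    (J : Fin N →₀ ℕ) :
    altSum i (M + 1) (fun J => totalDeriv i (F J) + shiftDown i F J) J
      = shiftDown i F J + (-1) ^ M * (totalDeriv i)^[M + 1] (F (J + idx i M)) := by
  induction M with
  | zero => simp [altSum, add_comm]
  | succ M ih =>
    rw [altSum] at ih ⊢
    rw [Finset.sum_range_succ, ih, totalDeriv_iterate_add,
      ← Function.iterate_succ_apply]
    have : J + idx i (M + 1) = J + idx i M + idx i 1 := by
      rw [add_assoc, ← Finsupp.single_add]
    rw [this, shiftDown_add_idx]
    ring

theorem altSum_telescope (i : Fin N) {M : ℕ} {F : (Fin N →₀ ℕ) → DiffPoly N}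
    (h : VanishesFrom M F) :
    altSum i (M + 1) (fun J => totalDeriv i (F J) + shiftDown i F J) = shiftDown i F := by
  funext J
  rw [altSum_succ_telescope, h, totalDeriv_iterate_zero, mul_zero, add_zero]
  simp

/-- Any cut-off beyond the order of P gives the same value, so several polynomials can share one
finite range. -/
theorem varDeriv₁_eq_altSum (i : Fin N) {P : DiffPoly N} {M : ℕ}
    (h : VanishesFrom M (fun J => MvPolynomial.pderiv J P)) :
    varDeriv₁ i P = altSum i M (fun J => MvPolynomial.pderiv J P) := by
  funext I
  rw [varDeriv₁, altSum]
  apply finsum_eq_sum_of_support_subset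
  intro α hα
  by_contra hM
  apply hα
  have : MvPolynomial.pderiv (I + idx i α) P = 0 := by
    apply h
    simp at hM ⊢
    omega
  simp only [this, totalDeriv_iterate_zero, mul_zero]

theorem varDeriv₂_eq_altSum (i j : Fin N) {P : DiffPoly N} {M : ℕ}
    (h : VanishesFrom M (fun J => MvPolynomial.pderiv J P)) :
    varDeriv₂ i j P = altSum i M (altSum j M (fun J => MvPolynomial.pderiv J P)) := by
  funext I
  rw [varDeriv₂]
  rw [finsum_eq_sum_of_support_subset (s := Finset.range M ×ˢ Finset.range M), Finset.sum_product]
  · simp only [altSum, totalDeriv_iterate_sum, totalDeriv_iterate_neg_one_pow_mul, Finset.mul_sum]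
    refine Finset.sum_congr rfl fun α _ => Finset.sum_congr rfl fun β _ => ?_
    ring
  · intro p hp
    by_contra hM
    apply hp
    have : MvPolynomial.pderiv (I + idx i p.1 + idx j p.2) P = 0 := by
      apply h
      simp at hM ⊢
      omega
    simp only [this, totalDeriv_iterate_zero, mul_zero]

theorem varDeriv₂_comm (i j : Fin N) (P : DiffPoly N) (I : Fin N →₀ ℕ) :
    varDeriv₂ i j P I = varDeriv₂ j i P I := by
  obtain ⟨M, hM⟩ := exists_vanishesFrom P
  rw [varDeriv₂_eq_altSum i j hM, varDeriv₂_eq_altSum j i hM, altSum_comm]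

theorem varDeriv₂_neg (i j : Fin N) (P : DiffPoly N) (I : Fin N →₀ ℕ) :
    varDeriv₂ i j (-P) I = - varDeriv₂ i j P I := by
  rw [varDeriv₂, varDeriv₂, ← finsum_neg_distrib]
  refine finsum_congr fun p => ?_
  rw [map_neg, totalDeriv_iterate_eq_pow, totalDeriv_iterate_eq_pow, map_neg, map_neg,
    totalDeriv_iterate_eq_pow, totalDeriv_iterate_eq_pow, mul_neg]

/-- The total derivative is annihilated by the variational derivative up to a boundary term. -/
theorem varDeriv₁_totalDeriv (i : Fin N) (P : DiffPoly N) :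
    varDeriv₁ i (totalDeriv i P) = shiftDown i (fun J => MvPolynomial.pderiv J P) := by
  obtain ⟨M, hM⟩ := exists_vanishesFrom P
  obtain ⟨M', hM'⟩ := exists_vanishesFrom (totalDeriv i P)
  rw [varDeriv₁_eq_altSum i (hM'.mono (le_trans (le_max_right M M') (Nat.le_succ _)))]
  simp only [pderiv_totalDeriv]
  exact altSum_telescope i (hM.mono (le_max_left M M'))

/-- The sums in the directions j and k commute with D_i and with the shift by i. They turn the
partial derivatives into δ_jk P, after which the sum in direction i telescopes. -/
theorem altSum_altSum_altSum_pderiv_totalDeriv {i j k : Fin N} (hij : i ≠ j) (hik : i ≠ k)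
    {P : DiffPoly N} {M : ℕ} (h : VanishesFrom M (fun J => MvPolynomial.pderiv J P)) :
    altSum i (M + 1) (altSum j (M + 1) (altSum k (M + 1)
      (fun J => MvPolynomial.pderiv J (totalDeriv i P)))) = shiftDown i (varDeriv₂ j k P) := by
  have h1 : (fun J => MvPolynomial.pderiv J (totalDeriv i P))
      = (fun J => totalDeriv i (MvPolynomial.pderiv J P))
        + shiftDown i (fun J => MvPolynomial.pderiv J P) := by
    funext J
    exact pderiv_totalDeriv i J P
  rw [h1, altSum_add, altSum_totalDeriv, altSum_shiftDown hik.symm, altSum_add, altSum_totalDeriv,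
    altSum_shiftDown hij.symm, varDeriv₂_eq_altSum j k (h.mono (Nat.le_succ M))]
  exact altSum_telescope i ((h.altSum k (M + 1)).altSum j (M + 1))

theorem altSum_mem {K : Ideal (DiffPoly N)} (hK : ∀ i, ∀ f ∈ K, totalDeriv i f ∈ K) (i : Fin N)
    (M : ℕ) {F : (Fin N →₀ ℕ) → DiffPoly N} (hF : ∀ J, F J ∈ K) (J : Fin N →₀ ℕ) :
    altSum i M F J ∈ K := by
  refine Ideal.sum_mem _ fun α _ => Ideal.mul_mem_left _ _ ?_
  have hf := hF (J + idx i α)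
  generalize F (J + idx i α) = f at hf
  clear * - hf hK
  induction α with
  | zero => exact hf
  | succ n ih =>
    rw [Function.iterate_succ_apply']
    exact hK i _ ih

/-- The coefficient of the exterior derivative of a two-form. -/
def extCoeff (L : Fin N → Fin N → DiffPoly N) (i j k : Fin N) : DiffPoly N :=
  totalDeriv i (L j k) + totalDeriv j (L k i) + totalDeriv k (L i j)

/-- The alternating sum over three directions of the derivatives of a coefficient of `dL` is a
combination of variational derivatives of the coefficients of `L`. -/
theorem shiftDown_varDeriv₂_mem {K : Ideal (DiffPoly N)}
    (hK : ∀ i, ∀ f ∈ K, totalDeriv i f ∈ K) (L : Fin N → Fin N → DiffPoly N) {i j k : Fin N}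
    (hij : i ≠ j) (hik : i ≠ k) (hjk : j ≠ k)
    (h : ∀ J, MvPolynomial.pderiv J (extCoeff L i j k) ∈ K) (J : Fin N →₀ ℕ) :
    shiftDown i (varDeriv₂ j k (L j k)) J + shiftDown j (varDeriv₂ k i (L k i)) J
      + shiftDown k (varDeriv₂ i j (L i j)) J ∈ K := by
  obtain ⟨M₁, h₁⟩ := exists_vanishesFrom (L j k)
  obtain ⟨M₂, h₂⟩ := exists_vanishesFrom (L k i)
  obtain ⟨M₃, h₃⟩ := exists_vanishesFrom (L i j)
  set M := max M₁ (max M₂ M₃)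
  have e₁ := altSum_altSum_altSum_pderiv_totalDeriv hij hik
    (h₁.mono (le_max_left M₁ (max M₂ M₃)))
  have e₂ := altSum_altSum_altSum_pderiv_totalDeriv hjk hij.symm
    (h₂.mono ((le_max_left M₂ M₃).trans (le_max_right M₁ _)))
  have e₃ := altSum_altSum_altSum_pderiv_totalDeriv hik.symm hjk.symm
    (h₃.mono ((le_max_right M₂ M₃).trans (le_max_right M₁ _)))
  rw [← e₁, ← e₂, ← e₃]
  -- Alternating sums in different directions commute, so the three terms merge into one triple sum
  -- over the derivatives of the coefficient of dL.
  have key : ∀ F G H : (Fin N →₀ ℕ) → DiffPoly N,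
      altSum i (M + 1) (altSum j (M + 1) (altSum k (M + 1) F)) J
      + altSum j (M + 1) (altSum k (M + 1) (altSum i (M + 1) G)) J
      + altSum k (M + 1) (altSum i (M + 1) (altSum j (M + 1) H)) J
      = altSum i (M + 1) (altSum j (M + 1) (altSum k (M + 1) (F + G + H))) J := by
    intro F G H
    rw [altSum_comm k i _ _ G, altSum_comm j i, altSum_comm k i, altSum_comm k j]
    simp only [altSum_add, Pi.add_apply]
  rw [key]
  refine altSum_mem hK i _ (altSum_mem hK j _ (altSum_mem hK k _ fun J => ?_)) J
  have := h J
  rw [extCoeff, map_add, map_add] at this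
  exact this

end Variational

/-! ### Subalgebras and homomorphisms compatible with the resolvent recursion -/

section ResolventFunctoriality

variable {A A' : Type*} [CommRing A] [Algebra ℝ A] [CommRing A'] [Algebra ℝ A']

theorem resolventCoeff_mem (S : Subalgebra ℝ A) (d : Derivation ℝ A A) (hd : ∀ a ∈ S, d a ∈ S)
    {u : A} (hu : u ∈ S) (k : ℕ) : resolventCoeff d u k ∈ S := by
  induction k using Nat.strong_induction_on with
  | _ k ih =>
    have h2 : (2 : A) ∈ S := S.natCast_mem 2
    cases k with
    | zero => rw [resolventCoeff]; exact S.algebraMap_mem _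
    | succ m =>
      rw [resolventCoeff]
      refine S.sub_mem (S.mul_mem h2 (S.sum_mem fun k _ => ?_)) (S.sum_mem fun k _ => ?_)
      · have h₁ := ih k (by omega)
        have h₂ := ih (m - k) (by omega)
        exact S.add_mem (S.sub_mem (S.mul_mem h₁ (hd _ (hd _ h₂)))
          (S.smul_mem (S.mul_mem (hd _ h₁) (hd _ h₂)) _))
          (S.mul_mem (S.mul_mem (S.mul_mem h2 hu) h₁) h₂)
      · exact S.mul_mem (ih (k + 1) (by omega)) (ih (m - k) (by omega))

theorem resolventB_mem (S : Subalgebra ℝ A) (d : Derivation ℝ A A) (hd : ∀ a ∈ S, d a ∈ S)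
    {u : A} (hu : u ∈ S) (k l : ℕ) : resolventB d u k l ∈ S := by
  have h4 : (4 : A) ∈ S := S.natCast_mem 4
  have hr := resolventCoeff_mem S d hd hu
  induction k generalizing l with
  | zero => rw [resolventB]; exact S.zero_mem
  | succ k ih =>
    rw [resolventB]
    exact S.add_mem (S.sub_mem (S.add_mem (S.sub_mem (S.add_mem
      (S.mul_mem (hr l) (hd _ (hd _ (hr k)))) (S.mul_mem (hr k) (hd _ (hd _ (hr l)))))
      (S.mul_mem (hd _ (hr k)) (hd _ (hr l))))
      (S.mul_mem (S.mul_mem (S.mul_mem h4 hu) (hr k)) (hr l)))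
      (S.mul_mem (hr k) (hr (l + 1)))) (ih (l + 1))

theorem map_resolventCoeff (f : A →ₐ[ℝ] A') (d : Derivation ℝ A A) (d' : Derivation ℝ A' A')
    (h : ∀ a, f (d a) = d' (f a)) (u : A) (k : ℕ) :
    f (resolventCoeff d u k) = resolventCoeff d' (f u) k := by
  induction k using Nat.strong_induction_on with
  | _ k ih =>
    cases k with
    | zero => rw [resolventCoeff, resolventCoeff]; exact f.commutes _
    | succ m =>
      rw [resolventCoeff, resolventCoeff]
      simp only [map_sub, map_mul, map_sum, map_add, map_smul, map_ofNat, h]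
      congr 1
      · congr 1
        refine Finset.sum_congr rfl fun k _ => ?_
        rw [ih k (by omega), ih (m - k) (by omega)]
      · refine Finset.sum_congr rfl fun k _ => ?_
        rw [ih (k + 1) (by omega), ih (m - k) (by omega)]

end ResolventFunctoriality

/-! ### Contraction of a differential with a variation -/

section Contraction

variable {N : ℕ} {C : Type*} [CommRing C] [Algebra ℝ C]

/-- The contraction `∑_I ev(∂P/∂v_I) η_I` of the differential of `P` with a family `η`. -/
def contraction (ev : DiffPoly N →ₐ[ℝ] C) (η : (Fin N →₀ ℕ) → C) (P : DiffPoly N) : C :=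
  ∑ I ∈ P.vars, ev (MvPolynomial.pderiv I P) * η I

variable (ev : DiffPoly N →ₐ[ℝ] C) (η : (Fin N →₀ ℕ) → C)

theorem contraction_eq_sum {P : DiffPoly N} {S : Finset (Fin N →₀ ℕ)}
    (h : ∀ I, I ∉ S → ev (MvPolynomial.pderiv I P) * η I = 0) :
    contraction ev η P = ∑ I ∈ S, ev (MvPolynomial.pderiv I P) * η I := by
  classical
  have h1 : contraction ev η P = ∑ I ∈ P.vars ∪ S, ev (MvPolynomial.pderiv I P) * η I := by
    refine Finset.sum_subset Finset.subset_union_left fun I _ hI => ?_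
    rw [MvPolynomial.pderiv_eq_zero_of_notMem_vars hI, map_zero, zero_mul]
  rw [h1]
  exact (Finset.sum_subset Finset.subset_union_right fun I _ hI => h I hI).symm

theorem contraction_eq_sum_of_subset {P : DiffPoly N} {S : Finset (Fin N →₀ ℕ)}
    (h : P.vars ⊆ S) :
    contraction ev η P = ∑ I ∈ S, ev (MvPolynomial.pderiv I P) * η I := by
  refine contraction_eq_sum ev η fun I hI => ?_
  rw [MvPolynomial.pderiv_eq_zero_of_notMem_vars (fun h' => hI (h h')), map_zero, zero_mul]

theorem contraction_C (c : ℝ) : contraction ev η (MvPolynomial.C c) = 0 := by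
  simp [contraction]

theorem contraction_X (I : Fin N →₀ ℕ) : contraction ev η (MvPolynomial.X I) = η I := by
  simp [contraction, MvPolynomial.vars_X]

theorem contraction_add (P Q : DiffPoly N) :
    contraction ev η (P + Q) = contraction ev η P + contraction ev η Q := by
  classical
  rw [contraction_eq_sum_of_subset ev η (MvPolynomial.vars_add_subset P Q),
    contraction_eq_sum_of_subset ev η (Finset.subset_union_left (s₁ := P.vars) (s₂ := Q.vars)),
    contraction_eq_sum_of_subset ev η (Finset.subset_union_right (s₁ := P.vars) (s₂ := Q.vars)),
    ← Finset.sum_add_distrib]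
  refine Finset.sum_congr rfl fun I _ => ?_
  rw [map_add, map_add, add_mul]

theorem contraction_mul (P Q : DiffPoly N) :
    contraction ev η (P * Q) = ev P * contraction ev η Q + ev Q * contraction ev η P := by
  classical
  rw [contraction_eq_sum_of_subset ev η (MvPolynomial.vars_mul P Q),
    contraction_eq_sum_of_subset ev η (Finset.subset_union_left (s₁ := P.vars) (s₂ := Q.vars)),
    contraction_eq_sum_of_subset ev η (Finset.subset_union_right (s₁ := P.vars) (s₂ := Q.vars)),
    Finset.mul_sum, Finset.mul_sum, ← Finset.sum_add_distrib]
  refine Finset.sum_congr rfl fun I _ => ?_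
  rw [Derivation.leibniz, map_add, smul_eq_mul, smul_eq_mul, map_mul, map_mul]
  ring

theorem contraction_smul (c : ℝ) (P : DiffPoly N) :
    contraction ev η (c • P) = c • contraction ev η P := by
  rw [MvPolynomial.smul_eq_C_mul, contraction_mul, contraction_C, mul_zero, add_zero,
    ← MvPolynomial.algebraMap_eq, AlgHom.commutes, Algebra.smul_def]

theorem contraction_neg (P : DiffPoly N) :
    contraction ev η (-P) = - contraction ev η P := by
  rw [← neg_one_smul ℝ P, contraction_smul, neg_one_smul]

theorem contraction_sub (P Q : DiffPoly N) :
    contraction ev η (P - Q) = contraction ev η P - contraction ev η Q := by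
  rw [sub_eq_add_neg, contraction_add, contraction_neg, sub_eq_add_neg]

/-- D_i is the variation along v_{t_i}. Thus one formula for contractions serves both total
derivatives of h_k and first variations on a field. -/
theorem totalDeriv_eq_contraction (i : Fin N) (P : DiffPoly N) :
    totalDeriv i P
      = contraction (AlgHom.id ℝ (DiffPoly N)) (fun I => jetVar (I + idx i 1)) P := by
  induction P using MvPolynomial.induction_on with
  | C a => rw [contraction_C, totalDeriv_C]
  | add p q hp hq => rw [contraction_add, map_add, hp, hq]
  | mul_X p I hp =>
    rw [contraction_mul, Derivation.leibniz, hp, contraction_X, totalDeriv_X]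
    rfl

theorem map_totalDeriv {ev : DiffPoly N →ₐ[ℝ] C} {i : Fin N} {d : Derivation ℝ C C}
    (h : ∀ I, ev (MvPolynomial.X (I + idx i 1)) = d (ev (MvPolynomial.X I))) (P : DiffPoly N) :
    ev (totalDeriv i P) = d (ev P) := by
  induction P using MvPolynomial.induction_on with
  | C a =>
    rw [totalDeriv_C, map_zero, ← MvPolynomial.algebraMap_eq, AlgHom.commutes, d.map_algebraMap]
  | add p q hp hq => simp only [map_add, hp, hq]
  | mul_X p I hp =>
    simp only [map_add, map_mul, Derivation.leibniz, totalDeriv_X, smul_eq_mul, h, hp]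

theorem contraction_totalDeriv {ev : DiffPoly N →ₐ[ℝ] C} {η : (Fin N →₀ ℕ) → C} {i : Fin N}
    {d : Derivation ℝ C C} (h : ∀ P, ev (totalDeriv i P) = d (ev P))
    (hη : ∀ I, η (I + idx i 1) = d (η I)) (P : DiffPoly N) :
    contraction ev η (totalDeriv i P) = d (contraction ev η P) := by
  induction P using MvPolynomial.induction_on with
  | C a => rw [totalDeriv_C, contraction_C, ← map_zero MvPolynomial.C, contraction_C, map_zero]
  | add p q hp hq => simp only [map_add, contraction_add, hp, hq]
  | mul_X p I hp =>
    simp only [Derivation.leibniz, contraction_add, contraction_mul, totalDeriv_X, smul_eq_mul,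
      contraction_X, hp, map_add, hη, h]
    rw [← totalDeriv_X, h]
    ring

end Contraction

/-! ### Integration by parts in a single direction -/

section OneDirection

variable {N : ℕ}

theorem varDeriv₁_add (i : Fin N) (P Q : DiffPoly N) (I : Fin N →₀ ℕ) :
    varDeriv₁ i (P + Q) I = varDeriv₁ i P I + varDeriv₁ i Q I := by
  obtain ⟨M₁, h₁⟩ := exists_vanishesFrom P
  obtain ⟨M₂, h₂⟩ := exists_vanishesFrom Q
  have h₁ := h₁.mono (le_max_left M₁ M₂)
  have h₂ := h₂.mono (le_max_right M₁ M₂)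
  have h₃ : VanishesFrom (max M₁ M₂) (fun J => MvPolynomial.pderiv J (P + Q)) := by
    intro J hJ
    have e₁ := h₁ J hJ
    have e₂ := h₂ J hJ
    simp only at e₁ e₂ ⊢
    rw [map_add, e₁, e₂, add_zero]
  rw [varDeriv₁_eq_altSum i h₁, varDeriv₁_eq_altSum i h₂, varDeriv₁_eq_altSum i h₃,
    ← Pi.add_apply, ← altSum_add]
  congr 1
  funext J
  simp

theorem varDeriv₂_eq_varDeriv₁ {i j : Fin N} {P : DiffPoly N} {I : Fin N →₀ ℕ}
    (h : ∀ α β, MvPolynomial.pderiv (I + idx i (α + 1) + idx j β) P = 0) :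
    varDeriv₂ i j P I = varDeriv₁ j P I := by
  obtain ⟨M, hM⟩ := exists_vanishesFrom P
  rw [varDeriv₂_eq_altSum i j (hM.mono (Nat.le_succ M)),
    varDeriv₁_eq_altSum j (hM.mono (Nat.le_succ M)), altSum, Finset.sum_range_succ',
    Finset.sum_eq_zero]
  · simp
  · intro α _
    rw [altSum, Finset.sum_eq_zero, totalDeriv_iterate_zero, mul_zero]
    intro β _
    rw [h, totalDeriv_iterate_zero, mul_zero]

theorem varDeriv₁_smul (i : Fin N) (c : ℝ) (P : DiffPoly N) (I : Fin N →₀ ℕ) :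
    varDeriv₁ i (c • P) I = c • varDeriv₁ i P I := by
  rw [varDeriv₁, varDeriv₁, smul_finsum]
  refine finsum_congr fun α => ?_
  rw [Derivation.map_smul, totalDeriv_iterate_eq_pow, totalDeriv_iterate_eq_pow, map_smul,
    mul_smul_comm]

/-- Split off the term α = 0 of δ_i P/δv_I; the remaining terms are -D_i of the sum defining δ_i
P/δv_(Ii). -/
theorem pderiv_eq_varDeriv₁_add (i : Fin N) (P : DiffPoly N) (I : Fin N →₀ ℕ) :
    MvPolynomial.pderiv I P
      = varDeriv₁ i P I + totalDeriv i (varDeriv₁ i P (I + idx i 1)) := by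
  obtain ⟨M, h⟩ := exists_vanishesFrom P
  have h₁ := congrFun (varDeriv₁_eq_altSum i (h.mono (Nat.le_succ M))) I
  have h₂ := congrFun (varDeriv₁_eq_altSum i h) (I + idx i 1)
  rw [h₁, h₂, altSum, altSum, Finset.sum_range_succ', map_sum, add_right_comm,
    ← Finset.sum_add_distrib,
    Finset.sum_eq_zero]
  · simp
  · intro α _
    rw [totalDeriv_neg_one_pow_mul, ← Function.iterate_succ_apply' (f := totalDeriv i),
      add_assoc I, ← Finsupp.single_add, add_comm 1 α]
    ring

theorem exists_varDeriv₁_eq_zero (i : Fin N) (P : DiffPoly N) :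
    ∃ M, VanishesFrom M (varDeriv₁ i P) := by
  obtain ⟨M, h⟩ := exists_vanishesFrom P
  refine ⟨M, ?_⟩
  rw [varDeriv₁_eq_altSum i h]
  exact h.altSum i M

theorem finsum_eq_sum_range_of_vanishesFrom {C : Type*} [AddCommMonoid C] {M : ℕ} {f : ℕ → C}
    (h : ∀ n, M ≤ n → f n = 0) : ∑ᶠ n, f n = ∑ n ∈ Finset.range M, f n := by
  apply finsum_eq_sum_of_support_subset
  intro n hn
  by_contra hM
  exact hn (h n (by simpa using hM))

variable [NeZero N]

/-- The contraction of the differential of a polynomial in the `x`-derivatives of `v`, integrated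
by parts. -/
theorem contraction_eq_varDeriv₁ {C : Type*} [CommRing C] [Algebra ℝ C]
    {ev : DiffPoly N →ₐ[ℝ] C} {η : (Fin N →₀ ℕ) → C} {d : Derivation ℝ C C}
    (hd : ∀ P, ev (totalDeriv 0 P) = d (ev P)) (hη : ∀ I, η (I + idx 0 1) = d (η I))
    {P : DiffPoly N} (hP : ∀ J, J ∉ Set.range (idx (0 : Fin N)) → MvPolynomial.pderiv J P = 0) :
    contraction ev η P = ev (varDeriv₁ 0 P 0) * η 0
      + d (∑ᶠ n : ℕ, η (idx 0 n) * ev (varDeriv₁ 0 P (idx 0 (n + 1)))) := by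
  obtain ⟨M, hM⟩ := exists_vanishesFrom P
  have hc : VanishesFrom M (varDeriv₁ 0 P) := by
    rw [varDeriv₁_eq_altSum 0 hM]
    exact hM.altSum 0 M
  rw [finsum_eq_sum_range_of_vanishesFrom (M := M)]
  · rw [contraction_eq_sum ev η (S := (Finset.range (M + 1)).map
      ⟨idx (0 : Fin N), Finsupp.single_injective 0⟩), Finset.sum_map]
    · have h₁ : ∑ n ∈ Finset.range (M + 1), ev (varDeriv₁ 0 P (idx 0 n)) * η (idx 0 n)
          = ev (varDeriv₁ 0 P 0) * η 0
            + ∑ n ∈ Finset.range M, ev (varDeriv₁ 0 P (idx 0 (n + 1))) * η (idx 0 (n + 1)) := by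
        rw [Finset.sum_range_succ', add_comm, idx, Finsupp.single_zero]
      have h₂ : ∑ n ∈ Finset.range (M + 1), d (ev (varDeriv₁ 0 P (idx 0 (n + 1)))) * η (idx 0 n)
          = ∑ n ∈ Finset.range M, d (ev (varDeriv₁ 0 P (idx 0 (n + 1)))) * η (idx 0 n) := by
        rw [Finset.sum_range_succ, hc (idx 0 (M + 1)) (by simp), map_zero, map_zero, zero_mul,
          add_zero]
      -- After this splitting, the second half at n and the first half at n+1 form the derivative of
      -- one product; the first half at n = 0 is left over.
      have h₃ : ∀ n, ev (MvPolynomial.pderiv (idx 0 n) P) * η (idx 0 n)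
          = ev (varDeriv₁ 0 P (idx 0 n)) * η (idx 0 n)
            + d (ev (varDeriv₁ 0 P (idx 0 (n + 1)))) * η (idx 0 n) := fun n => by
        rw [pderiv_eq_varDeriv₁_add 0 P, map_add, hd, add_mul, ← Finsupp.single_add]
      have h₄ : ∀ n, d (η (idx 0 n)) = η (idx 0 (n + 1)) := fun n => by
        rw [← hη, ← Finsupp.single_add]
      simp only [Function.Embedding.coeFn_mk, h₃, Finset.sum_add_distrib, h₁, h₂, map_sum,
        Derivation.leibniz, smul_eq_mul, h₄]
      rw [add_assoc, add_comm (Finset.sum _ _) (Finset.sum _ _)]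
      congr 2
      exact Finset.sum_congr rfl fun n _ => mul_comm _ _
    · intro I hI
      by_cases h : I ∈ Set.range (idx (0 : Fin N))
      · obtain ⟨n, rfl⟩ := h
        have : MvPolynomial.pderiv (idx 0 n) P = 0 := by
          apply hM
          simp at hI ⊢
          omega
        rw [this, map_zero, zero_mul]
      · rw [hP I h, map_zero, zero_mul]
  · intro n hn
    rw [hc, map_zero, mul_zero]
    simp
    omega

end OneDirection

/-! ### Differential polynomials in a restricted set of jets -/

section Supported

variable {N : ℕ}

theorem pderiv_eq_zero_of_mem_supported {s : Set (Fin N →₀ ℕ)} {P : DiffPoly N}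
    (hP : P ∈ MvPolynomial.supported ℝ s) {J : Fin N →₀ ℕ} (hJ : J ∉ s) :
    MvPolynomial.pderiv J P = 0 :=
  MvPolynomial.pderiv_eq_zero_of_notMem_vars
    fun h => hJ (MvPolynomial.mem_supported.mp hP (Finset.mem_coe.mpr h))

theorem totalDeriv_mem_supported {s : Set (Fin N →₀ ℕ)} {i : Fin N}
    (hs : ∀ I ∈ s, I + idx i 1 ∈ s) {P : DiffPoly N} (hP : P ∈ MvPolynomial.supported ℝ s) :
    totalDeriv i P ∈ MvPolynomial.supported ℝ s := by
  rw [MvPolynomial.supported_eq_adjoin_X] at hP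
  induction hP using Algebra.adjoin_induction with
  | mem x hx =>
    obtain ⟨I, hI, rfl⟩ := hx
    rw [totalDeriv_X]
    exact MvPolynomial.X_mem_supported.mpr (hs I hI)
  | algebraMap r =>
    rw [Derivation.map_algebraMap]
    exact Subalgebra.zero_mem _
  | add x y _ _ hx hy =>
    rw [map_add]
    exact Subalgebra.add_mem _ hx hy
  | mul x y hx' hy' hx hy =>
    rw [Derivation.leibniz]
    rw [← MvPolynomial.supported_eq_adjoin_X] at hx' hy'
    exact Subalgebra.add_mem _ (Subalgebra.mul_mem _ hx' hy) (Subalgebra.mul_mem _ hy' hx)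

theorem pderiv_mem_supported {s : Set (Fin N →₀ ℕ)} (J : Fin N →₀ ℕ) {P : DiffPoly N}
    (hP : P ∈ MvPolynomial.supported ℝ s) :
    MvPolynomial.pderiv J P ∈ MvPolynomial.supported ℝ s := by
  classical
  rw [MvPolynomial.supported_eq_adjoin_X] at hP
  induction hP using Algebra.adjoin_induction with
  | mem x hx =>
    obtain ⟨I, hI, rfl⟩ := hx
    rw [MvPolynomial.pderiv_X, Pi.single_apply]
    split_ifs
    · exact Subalgebra.one_mem _
    · exact Subalgebra.zero_mem _
  | algebraMap r =>
    rw [Derivation.map_algebraMap]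
    exact Subalgebra.zero_mem _
  | add x y _ _ hx hy =>
    rw [map_add]
    exact Subalgebra.add_mem _ hx hy
  | mul x y hx' hy' hx hy =>
    rw [Derivation.leibniz]
    rw [← MvPolynomial.supported_eq_adjoin_X] at hx' hy'
    exact Subalgebra.add_mem _ (Subalgebra.mul_mem _ hx' hy) (Subalgebra.mul_mem _ hy' hx)

end Supported

/-! ### Variational derivatives of the KdV coefficients -/

section KdVCoefficients

variable (N : ℕ) [NeZero N]

/-- The differential polynomials in the derivatives `v_x, v_xx, ...` -/
def xJets : Subalgebra ℝ (DiffPoly N) :=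
  MvPolynomial.supported ℝ (Set.range fun n => idx (0 : Fin N) (n + 1))

variable {N}

theorem totalDeriv_mem_xJets {P : DiffPoly N} (hP : P ∈ xJets N) : totalDeriv 0 P ∈ xJets N := by
  apply totalDeriv_mem_supported _ hP
  rintro _ ⟨n, rfl⟩
  exact ⟨n + 1, Finsupp.single_add _ _ _⟩

theorem jetVar_mem_xJets (n : ℕ) : (jetVar (idx 0 (n + 1)) : DiffPoly N) ∈ xJets N :=
  MvPolynomial.X_mem_supported.mpr ⟨n, rfl⟩

theorem pderiv_eq_zero_of_mem_xJets {P : DiffPoly N} (hP : P ∈ xJets N) {J : Fin N →₀ ℕ}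
    (hJ : ∀ n, J ≠ idx 0 (n + 1)) : MvPolynomial.pderiv J P = 0 :=
  pderiv_eq_zero_of_mem_supported hP (by rintro ⟨n, hn⟩; exact hJ n hn.symm)

theorem pderiv_eq_zero_of_mem_xJets_of_zero {P : DiffPoly N} (hP : P ∈ xJets N)
    {J : Fin N →₀ ℕ} (hJ : J 0 = 0) : MvPolynomial.pderiv J P = 0 := by
  refine pderiv_eq_zero_of_mem_xJets hP fun n h => ?_
  rw [h] at hJ
  simp at hJ

theorem pderiv_eq_zero_of_mem_xJets_of_ne {P : DiffPoly N} (hP : P ∈ xJets N)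
    {J : Fin N →₀ ℕ} {i : Fin N} (hi : i ≠ 0) (hJ : J i ≠ 0) : MvPolynomial.pderiv J P = 0 := by
  refine pderiv_eq_zero_of_mem_xJets hP fun n h => hJ ?_
  rw [h]
  simp [hi.symm]

theorem varDeriv₁_mem_xJets {P : DiffPoly N} (hP : P ∈ xJets N) (J : Fin N →₀ ℕ) :
    varDeriv₁ 0 P J ∈ xJets N := by
  obtain ⟨M, hM⟩ := exists_vanishesFrom P
  rw [varDeriv₁_eq_altSum 0 hM]
  refine Subalgebra.sum_mem _ fun α _ => ?_
  rw [neg_one_pow_mul_eq_smul]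
  refine Subalgebra.smul_mem _ ?_ _
  induction α with
  | zero => exact pderiv_mem_supported _ hP
  | succ n ih =>
    have h : ∀ m, (totalDeriv 0)^[m] (MvPolynomial.pderiv (J + idx 0 (n + 1)) P) ∈ xJets N := by
      intro m
      induction m with
      | zero => exact pderiv_mem_supported _ hP
      | succ m ihm =>
        rw [Function.iterate_succ_apply']
        exact totalDeriv_mem_xJets ihm
    exact h (n + 1)

theorem kdvG_mem_xJets (k : ℕ) : kdvG N k ∈ xJets N :=
  resolventCoeff_mem _ _ (fun _ h => totalDeriv_mem_xJets h) (jetVar_mem_xJets 0) k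

theorem kdvB_mem_xJets (k l : ℕ) : kdvB N k l ∈ xJets N :=
  resolventB_mem _ _ (fun _ h => totalDeriv_mem_xJets h) (jetVar_mem_xJets 0) k l

theorem kdvH_mem_xJets (k : ℕ) : kdvH N k ∈ xJets N :=
  Subalgebra.smul_mem _ (kdvG_mem_xJets _) _

/-- `δ_1 r_(k+1) / δv = (4k+2) r_k`, for the coefficients evaluated on `u = v`. -/
theorem varDeriv₁_resolventCoeff {j : Fin N} (hj : j ≠ 0) (k : ℕ) :
    varDeriv₁ 0 (resolventCoeff (totalDeriv (0 : Fin N)) (jetVar 0) (k + 1)) 0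
      = (4 * (k : ℝ) + 2) • resolventCoeff (totalDeriv (0 : Fin N)) (jetVar 0) k := by
  set q := resolventCoeff (totalDeriv (0 : Fin N)) (jetVar 0) with hq
  have hmem : ∀ k, q k ∈ MvPolynomial.supported ℝ (Set.range (idx (0 : Fin N))) := fun k => by
    refine resolventCoeff_mem _ _ (fun _ h => totalDeriv_mem_supported ?_ h) ?_ k
    · rintro _ ⟨n, rfl⟩
      exact ⟨n + 1, Finsupp.single_add _ _ _⟩
    · exact MvPolynomial.X_mem_supported.mpr ⟨0, by simp [idx]⟩
  have hne : ∀ α, idx j 1 + idx (0 : Fin N) α ∉ Set.range (idx (0 : Fin N)) := by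
    rintro α ⟨n, hn⟩
    have := DFunLike.congr_fun hn j
    simp [hj] at this
  -- D_j with j ≠ 0 serves as a universal variation: it sends v to v_{t_j}, and the coefficients q
  -- contain no derivatives in t_j. Taking δ_1/δv_{t_j} of the identity then reads off the factor of
  -- the variation.
  obtain ⟨s, hs⟩ := resolventCoeff_variation (totalDeriv (0 : Fin N)) (totalDeriv j)
    (totalDeriv_comm 0 j) (jetVar 0) k
  have hs' := congrArg (fun P => varDeriv₁ 0 P (idx j 1)) hs
  simp only [← hq] at hs'
  have hL : varDeriv₁ 0 (totalDeriv j (q (k + 1))) (idx j 1) = varDeriv₁ 0 (q (k + 1)) 0 := by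
    rw [varDeriv₁, varDeriv₁]
    refine finsum_congr fun α => ?_
    rw [pderiv_totalDeriv, pderiv_eq_zero_of_mem_supported (hmem _) (hne α), map_zero, zero_add,
      add_comm (idx j 1), shiftDown_add_idx, zero_add]
  have hR : varDeriv₁ 0 ((4 * (k : DiffPoly N) + 2) * (q k * totalDeriv j (jetVar 0))) (idx j 1)
      = (4 * (k : ℝ) + 2) • q k := by
    have h4 : (4 * (k : DiffPoly N) + 2) * (q k * totalDeriv j (jetVar 0))
        = (4 * (k : ℝ) + 2) • (q k * totalDeriv j (jetVar 0)) := by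
      rw [MvPolynomial.smul_eq_C_mul, map_add, map_mul, map_natCast, map_ofNat, map_ofNat]
    rw [h4, varDeriv₁_smul, varDeriv₁, finsum_eq_single _ 0]
    · congr 1
      simp only [pow_zero, one_mul, Function.iterate_zero, id, totalDeriv_X, zero_add,
        Derivation.leibniz, smul_eq_mul]
      rw [pderiv_eq_zero_of_mem_supported (hmem _) (hne 0), idx, idx, Finsupp.single_zero, add_zero,
        MvPolynomial.pderiv_X_self]
      ring
    · intro α hα
      have : MvPolynomial.pderiv (idx j 1 + idx 0 α)
          (q k * totalDeriv j (jetVar (0 : Fin N →₀ ℕ))) = 0 := by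
        rw [totalDeriv_X, zero_add, Derivation.leibniz,
          pderiv_eq_zero_of_mem_supported (hmem _) (hne α), MvPolynomial.pderiv_X_of_ne]
        · simp
        · intro h
          have := DFunLike.congr_fun h 0
          simp [hj] at this
          exact hα this.symm
      rw [this, totalDeriv_iterate_zero, mul_zero]
  -- The boundary term of δ_1(D_x s) is indexed by a multi-index without x, hence zero.
  rw [hL, varDeriv₁_add, hR, varDeriv₁_totalDeriv] at hs'
  rw [hs', shiftDown, if_pos (by simp [hj]), add_zero]

/-- The substitution of `v_x` for `v`. -/
def substX (N : ℕ) [NeZero N] : DiffPoly N →ₐ[ℝ] DiffPoly N :=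
  MvPolynomial.rename fun I => I + idx 0 1

theorem substX_totalDeriv (i : Fin N) (P : DiffPoly N) :
    substX N (totalDeriv i P) = totalDeriv i (substX N P) := by
  refine map_totalDeriv (fun I => ?_) P
  simp only [substX, MvPolynomial.rename_X, totalDeriv_X]
  rw [add_right_comm]

theorem kdvG_eq_substX (k : ℕ) :
    kdvG N k = substX N (resolventCoeff (totalDeriv (0 : Fin N)) (jetVar 0) k) := by
  rw [map_resolventCoeff (substX N) _ _ (substX_totalDeriv 0), kdvG]
  simp [substX]

/-- The substitution renames jet variables injectively and commutes with D_x, so it can be applied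
term by term. It transfers δ/δu of r_k[u] to δ/δv_x of r_k[v_x]. -/
theorem varDeriv₁_substX (P : DiffPoly N) (J : Fin N →₀ ℕ) :
    varDeriv₁ 0 (substX N P) (J + idx 0 1) = substX N (varDeriv₁ 0 P J) := by
  have hinj : Function.Injective fun I : Fin N →₀ ℕ => I + idx 0 1 := add_left_injective _
  have hit : ∀ n (Q : DiffPoly N), substX N ((totalDeriv 0)^[n] Q)
      = (totalDeriv 0)^[n] (substX N Q) := fun n Q => by
    induction n generalizing Q with
    | zero => rfl
    | succ n ih => rw [Function.iterate_succ_apply, ih, substX_totalDeriv,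
        Function.iterate_succ_apply]
  rw [varDeriv₁, varDeriv₁]
  refine Eq.trans (finsum_congr fun α => ?_) (AddMonoidHom.map_finsum_of_injective
    (substX N : DiffPoly N →+ DiffPoly N) (MvPolynomial.rename_injective _ hinj) _).symm
  change _ = substX N ((-1) ^ α * (totalDeriv 0)^[α] (MvPolynomial.pderiv (J + idx 0 α) P))
  have : J + idx 0 1 + idx 0 α = (J + idx 0 α) + idx 0 1 := add_right_comm _ _ _
  rw [map_mul, map_pow, map_neg, map_one, hit, this]
  congr 2
  exact MvPolynomial.pderiv_rename hinj _ P

/-- The normalization 1/(4k+2) of h_k is chosen to cancel the factor in the variation of r_{k+1}. -/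
theorem varDeriv₁_kdvH {j : Fin N} (hj : j ≠ 0) (k : ℕ) :
    varDeriv₁ 0 (kdvH N k) (idx 0 1) = kdvG N k := by
  have h0 : idx (0 : Fin N) 1 = 0 + idx 0 1 := (zero_add _).symm
  rw [kdvH, varDeriv₁_smul, kdvG_eq_substX, h0, varDeriv₁_substX, varDeriv₁_resolventCoeff hj,
    map_smul, smul_smul, ← kdvG_eq_substX, one_div, inv_mul_cancel₀ (by positivity), one_smul]

/-- Since h_k does not contain v undifferentiated, ∂h_k/∂v = 0 and one integration by parts leaves
only the term from δ_1 h_k/δv_x. -/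
theorem varDeriv₁_kdvH_zero {j : Fin N} (hj : j ≠ 0) (k : ℕ) :
    varDeriv₁ 0 (kdvH N k) 0 = - totalDeriv 0 (kdvG N k) := by
  have h := pderiv_eq_varDeriv₁_add 0 (kdvH N k) 0
  rw [zero_add, varDeriv₁_kdvH hj,
    pderiv_eq_zero_of_mem_xJets_of_zero (kdvH_mem_xJets k) (by simp)] at h
  exact eq_neg_of_add_eq_zero_left h.symm

/-- The contraction of the differential of `h_k` with a family `η`, integrated by parts. -/
theorem contraction_kdvH {C : Type*} [CommRing C] [Algebra ℝ C] {ev : DiffPoly N →ₐ[ℝ] C}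
    {η : (Fin N →₀ ℕ) → C} {d : Derivation ℝ C C} (hd : ∀ P, ev (totalDeriv 0 P) = d (ev P))
    (hη : ∀ I, η (I + idx 0 1) = d (η I)) {j : Fin N} (hj : j ≠ 0) (k : ℕ) :
    contraction ev η (kdvH N k) = - d (ev (kdvG N k)) * η 0
      + d (∑ᶠ n : ℕ, η (idx 0 n) * ev (varDeriv₁ 0 (kdvH N k) (idx 0 (n + 1)))) := by
  rw [contraction_eq_varDeriv₁ hd hη, varDeriv₁_kdvH_zero hj, map_neg, hd]
  intro J hJ
  refine pderiv_eq_zero_of_mem_xJets (kdvH_mem_xJets k) fun n hn => hJ ⟨n + 1, hn.symm⟩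

end KdVCoefficients

/-! ### Differential ideals and partial derivatives -/

section DifferentialIdeal

variable {N : ℕ}

theorem subset_differentialIdeal (S : Set (DiffPoly N)) : S ⊆ differentialIdeal S := by
  intro P hP
  rw [differentialIdeal, SetLike.mem_coe, Submodule.mem_sInf]
  exact fun K hK => hK.1 hP

theorem totalDeriv_mem_differentialIdeal {S : Set (DiffPoly N)} (i : Fin N) {P : DiffPoly N}
    (hP : P ∈ differentialIdeal S) : totalDeriv i P ∈ differentialIdeal S := by
  rw [differentialIdeal, Submodule.mem_sInf] at hP ⊢
  exact fun K hK => hK.2 i P (hP K hK)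

theorem differentialIdeal_le {S : Set (DiffPoly N)} {K : Ideal (DiffPoly N)} (hS : S ⊆ K)
    (hK : ∀ i, ∀ f ∈ K, totalDeriv i f ∈ K) : differentialIdeal S ≤ K :=
  sInf_le ⟨hS, hK⟩

/-- If all derivatives of `P` lie in a differential ideal, so do all derivatives of `D_i P`. -/
theorem pderiv_totalDeriv_mem {K : Ideal (DiffPoly N)} (hK : ∀ i, ∀ f ∈ K, totalDeriv i f ∈ K)
    (i : Fin N) {P : DiffPoly N} (hP : ∀ J, MvPolynomial.pderiv J P ∈ K) (J : Fin N →₀ ℕ) :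
    MvPolynomial.pderiv J (totalDeriv i P) ∈ K := by
  rw [pderiv_totalDeriv]
  refine K.add_mem (hK i _ (hP J)) ?_
  rw [shiftDown]
  split_ifs
  · exact K.zero_mem
  · exact hP _

/-- If all derivatives of `D_i P` lie in a differential ideal, so do all derivatives of `P`. -/
theorem pderiv_mem_of_pderiv_totalDeriv_mem {K : Ideal (DiffPoly N)}
    (hK : ∀ i, ∀ f ∈ K, totalDeriv i f ∈ K) (i : Fin N) {P : DiffPoly N}
    (hP : ∀ J, MvPolynomial.pderiv J (totalDeriv i P) ∈ K) (J : Fin N →₀ ℕ) :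
    MvPolynomial.pderiv J P ∈ K := by
  obtain ⟨M, hM⟩ := exists_vanishesFrom P
  -- Descending induction on the degree of J: the commutator formula at J + i expresses ∂P/∂v_J by
  -- ∂(D_i P)/∂v_(Ji) and D_i of ∂P/∂v_(Ji).
  have key : ∀ n (J : Fin N →₀ ℕ), M ≤ J.degree + n → MvPolynomial.pderiv J P ∈ K := by
    intro n
    induction n with
    | zero =>
      intro J hJ
      have h0 : MvPolynomial.pderiv J P = 0 := hM J hJ
      rw [h0]
      exact K.zero_mem
    | succ n ih =>
      intro J hJ
      have h := hP (J + idx i 1)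
      rw [pderiv_totalDeriv, shiftDown_add_idx] at h
      have h' : MvPolynomial.pderiv (J + idx i 1) P ∈ K := by
        apply ih
        rw [map_add, Finsupp.degree_single]
        omega
      exact (K.add_mem_iff_right (hK i _ h')).mp h
  exact key M J (Nat.le_add_left _ _)

end DifferentialIdeal

/-! ### Closedness of the Lagrangian two-form and its Euler–Lagrange equations -/

section Lagrangian

variable {N : ℕ} [NeZero N]

theorem kdvLagrangian_swap (i j : Fin N) : kdvLagrangian N j i = - kdvLagrangian N i j := by
  rw [kdvLagrangian, kdvLagrangian]
  rcases lt_trichotomy i j with h | h | h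
  · rw [if_neg h.asymm, if_pos h, if_pos h]
  · subst h
    simp
  · rw [if_pos h, if_neg h.asymm, if_pos h, neg_neg]

theorem kdvLagrangian_zero {i : Fin N} (hi : i ≠ 0) :
    kdvLagrangian N 0 i = (1 / 2 : ℝ) • (jetVar (idx 0 1) * jetVar (idx i 1)) - kdvH N (i + 1) := by
  rw [kdvLagrangian, if_pos (Fin.pos_iff_ne_zero.mpr hi), kdvLagrangianAux, if_pos rfl]

theorem kdvLagrangian_of_ne {i j : Fin N} (hi : i ≠ 0) (hj : j ≠ 0) (hij : i ≠ j) :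
    kdvLagrangian N i j =
      (1 / 2 : ℝ) • (jetVar (idx i 1) * kdvG N (j + 1) - jetVar (idx j 1) * kdvG N (i + 1))
      + (kdvA N i j - kdvA N j i)
      - (1 / 2 : ℝ) • (kdvB N (i + 1) (j + 1) - kdvB N (j + 1) (i + 1)) := by
  rw [kdvLagrangian]
  rcases lt_or_gt_of_ne hij with h | h
  · rw [if_pos h, kdvLagrangianAux, if_neg hi]
  · rw [if_neg h.asymm, if_pos h, kdvLagrangianAux, if_neg hj]
    module

/-- Integration by parts along the variation v_{t_j}; its boundary sum is exactly a_kj, which is why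
a_ij enters the Lagrangian. -/
theorem totalDeriv_kdvH {i : Fin N} (hi : i ≠ 0) (k j : Fin N) :
    totalDeriv j (kdvH N (k + 1)) = - totalDeriv 0 (kdvG N (k + 1)) * jetVar (idx j 1)
      + totalDeriv 0 (kdvA N k j) := by
  rw [totalDeriv_eq_contraction j, contraction_kdvH (d := totalDeriv 0) (fun _ => rfl) _ hi]
  · rw [kdvA, zero_add]
    rfl
  · intro I
    rw [totalDeriv_X, add_right_comm]

/-- The coefficient of `dx ∧ dt_i ∧ dt_j` in `dL` has a double zero on solutions. -/
theorem extCoeff_kdvLagrangian_zero {i j : Fin N} (hi : i ≠ 0) (hj : j ≠ 0) (hij : i ≠ j) :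
    extCoeff (kdvLagrangian N) 0 i j
      = (1 / 2 : ℝ) • (pkdv N i * totalDeriv 0 (pkdv N j)
        - pkdv N j * totalDeriv 0 (pkdv N i)) := by
  have h2 : ∀ P : DiffPoly N, (1 / 2 : ℝ) • P = MvPolynomial.C (1 / 2) * P := fun P =>
    MvPolynomial.smul_eq_C_mul _ _
  have h1 : (2 : DiffPoly N) * MvPolynomial.C (1 / 2) = 1 := by
    rw [← map_ofNat MvPolynomial.C 2, ← map_mul]
    norm_num
  have h3 : ∀ i : Fin N, totalDeriv i (MvPolynomial.C (1 / 2)) = 0 := fun i => totalDeriv_C i _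
  rw [extCoeff, kdvLagrangian_swap 0 j, kdvLagrangian_zero hi, kdvLagrangian_zero hj,
    kdvLagrangian_of_ne hi hj hij]
  -- The terms D_x a_ij and D_x a_ji cancel against D_j h_i and D_i h_j, and b_ij - b_ji supplies
  -- the products g_i D_x g_j - g_j D_x g_i missing from the double zero.
  simp only [map_neg, map_sub, map_add, Derivation.leibniz, smul_eq_mul, totalDeriv_X,
    totalDeriv_kdvH hi, totalDeriv_kdvB, pkdv, h2, h3]
  rw [add_comm (idx (0 : Fin N) 1) (idx j 1), add_comm (idx (0 : Fin N) 1) (idx i 1),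
    add_comm (idx j 1) (idx i 1)]
  linear_combination (MvPolynomial.X (idx i 1) * totalDeriv 0 (kdvG N (j + 1))
    - MvPolynomial.X (idx j 1) * totalDeriv 0 (kdvG N (i + 1))) * h1

/-- For coefficients with dx, the Leibniz rule leaves a factor E or D_x E in every term. The other
coefficients are reached through d(dL) = 0. -/
theorem pderiv_extCoeff_mem {i j k : Fin N} (hij : i ≠ j) (hik : i ≠ k) (hjk : j ≠ k)
    (J : Fin N →₀ ℕ) :
    MvPolynomial.pderiv J (extCoeff (kdvLagrangian N) i j k)
      ∈ differentialIdeal (pkdvSystem N) := by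
  set K := differentialIdeal (pkdvSystem N) with hKdef
  have hK : ∀ i, ∀ f ∈ K, totalDeriv i f ∈ K := fun i f hf => totalDeriv_mem_differentialIdeal i hf
  have hE : ∀ i : Fin N, i ≠ 0 → pkdv N i ∈ K := fun i hi =>
    subset_differentialIdeal _ ⟨i, hi, rfl⟩
  have hzero : ∀ i j : Fin N, i ≠ 0 → j ≠ 0 → i ≠ j → ∀ J,
      MvPolynomial.pderiv J (extCoeff (kdvLagrangian N) 0 i j) ∈ K := by
    intro i j hi hj hij J
    rw [extCoeff_kdvLagrangian_zero hi hj hij, Derivation.map_smul, map_sub, Derivation.leibniz,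
      Derivation.leibniz]
    refine Submodule.smul_of_tower_mem K _ (K.sub_mem (K.add_mem ?_ ?_) (K.add_mem ?_ ?_))
    · exact K.mul_mem_right _ (hE i hi)
    · exact K.mul_mem_right _ (hK 0 _ (hE j hj))
    · exact K.mul_mem_right _ (hE j hj)
    · exact K.mul_mem_right _ (hK 0 _ (hE i hi))
  have hcyc : ∀ i j k : Fin N, extCoeff (kdvLagrangian N) i j k
      = extCoeff (kdvLagrangian N) j k i := fun i j k => by
    simp only [extCoeff]
    ring
  by_cases hi : i = 0
  · subst hi
    exact hzero j k hij.symm hik.symm hjk J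
  by_cases hj : j = 0
  · subst hj
    rw [hcyc]
    exact hzero k i hjk.symm hij hik.symm J
  by_cases hk : k = 0
  · subst hk
    rw [hcyc, hcyc]
    exact hzero i j hik hjk hij J
  refine pderiv_mem_of_pderiv_totalDeriv_mem hK 0 (fun J => ?_) J
  -- This is d(dL) = 0. It controls only D_x of the coefficient, and the descending induction then
  -- removes D_x.
  have h : totalDeriv 0 (extCoeff (kdvLagrangian N) i j k)
      = totalDeriv i (extCoeff (kdvLagrangian N) 0 j k)
        + totalDeriv j (extCoeff (kdvLagrangian N) 0 k i)
        + totalDeriv k (extCoeff (kdvLagrangian N) 0 i j) := by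
    simp only [extCoeff, map_add]
    rw [kdvLagrangian_swap 0 i, kdvLagrangian_swap 0 j, kdvLagrangian_swap 0 k]
    simp only [map_neg, totalDeriv_comm 0, totalDeriv_comm j i, totalDeriv_comm k i,
      totalDeriv_comm k j]
    ring
  rw [h, map_add, map_add]
  exact K.add_mem (K.add_mem
    (pderiv_totalDeriv_mem hK i (hzero j k hj hk hjk) J)
    (pderiv_totalDeriv_mem hK j (hzero k i hk hi (Ne.symm hik)) J))
    (pderiv_totalDeriv_mem hK k (hzero i j hi hj hij) J)

/-- The multi-time Euler-Lagrange equations are differential consequences of the PKdV equations. -/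
theorem multiTimeEL_kdvLagrangian_subset (hN : 3 ≤ N) {P : DiffPoly N}
    (hP : P ∈ multiTimeEL (kdvLagrangian N)) : P ∈ differentialIdeal (pkdvSystem N) := by
  have key : ∀ i j k : Fin N, i ≠ j → i ≠ k → j ≠ k → ∀ J, _ := fun i j k hij hik hjk =>
    shiftDown_varDeriv₂_mem (K := differentialIdeal (pkdvSystem N))
      (fun i f hf => totalDeriv_mem_differentialIdeal i hf) (kdvLagrangian N) hij hik hjk
      (pderiv_extCoeff_mem hij hik hjk)
  rcases hP with (⟨i, j, I, hij, hi, hj, rfl⟩ | ⟨i, j, k, I, hij, hik, hjk, hi, rfl⟩) |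
    ⟨i, j, k, I, hij, hik, hjk, rfl⟩
  -- The first family involves only two directions; N ≥ 3 provides a third. At the multi-index Ik
  -- only the shift by k contributes.
  · obtain ⟨k, hk⟩ : ∃ k, k ∉ ({i, j} : Finset (Fin N)) := by
      by_contra! h
      have h₁ := Finset.card_le_card (s := Finset.univ) (t := {i, j}) fun k _ => h k
      have h₂ := Finset.card_le_two (a := i) (b := j)
      rw [Finset.card_univ, Fintype.card_fin] at h₁
      omega
    simp only [Finset.mem_insert, Finset.mem_singleton, not_or] at hk
    have h := key i j k hij (Ne.symm hk.1) (Ne.symm hk.2) (I + idx k 1)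
    rw [shiftDown_add_idx, shiftDown, if_pos (by simp [hi, hk.1]), shiftDown,
      if_pos (by simp [hj, hk.2]), zero_add, zero_add] at h
    exact h
  -- At Ijk, with i not in I, the shifts by j and k contribute; the antisymmetry of L makes the sum
  -- a difference.
  · have h := key i j k hij hik hjk (I + idx j 1 + idx k 1)
    rw [shiftDown_add_idx, shiftDown, if_pos (by simp [hi, hij.symm, hik.symm]), zero_add,
      add_right_comm I, shiftDown_add_idx, kdvLagrangian_swap i k, varDeriv₂_neg,
        varDeriv₂_comm k i,
      neg_add_eq_sub] at h
    exact h
  -- At Iijk all three shifts contribute.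
  · have h := key i j k hij hik hjk (I + idx i 1 + idx j 1 + idx k 1)
    have e₁ : I + idx i 1 + idx j 1 + idx k 1 = I + idx j 1 + idx k 1 + idx i 1 := by abel
    have e₂ : I + idx i 1 + idx j 1 + idx k 1 = I + idx k 1 + idx i 1 + idx j 1 := by abel
    rw [shiftDown_add_idx] at h
    rw [e₁, shiftDown_add_idx, ← e₁, e₂, shiftDown_add_idx] at h
    convert h using 1
    ring

/-- The multi-indices of the jet variables in `L_(ij)`, for `i, j` different from `x`. -/
def lagrangianJets (i j : Fin N) : Set (Fin N →₀ ℕ) :=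
  (Set.range fun n => idx 0 (n + 1)) ∪ (Set.range fun n => idx 0 n + idx i 1)
    ∪ (Set.range fun n => idx 0 n + idx j 1)

theorem exists_kdvA_eq_sum (i j : Fin N) : ∃ M₀, ∀ M, M₀ ≤ M → kdvA N i j
    = ∑ n ∈ Finset.range M, jetVar (idx 0 n + idx j 1)
      * varDeriv₁ 0 (kdvH N (i + 1)) (idx 0 (n + 1)) := by
  obtain ⟨M₀, h⟩ := exists_varDeriv₁_eq_zero 0 (kdvH N (i + 1))
  refine ⟨M₀, fun M hM => finsum_eq_sum_range_of_vanishesFrom fun n hn => ?_⟩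
  rw [h, mul_zero]
  simp
  omega

theorem kdvA_mem_supported (i j : Fin N) : kdvA N i j ∈ MvPolynomial.supported ℝ
    ((Set.range fun n => idx (0 : Fin N) (n + 1)) ∪ (Set.range fun n => idx 0 n + idx j 1)) := by
  obtain ⟨M, hM⟩ := exists_kdvA_eq_sum i j
  rw [hM M le_rfl]
  refine Subalgebra.sum_mem _ fun n _ => Subalgebra.mul_mem _ ?_ ?_
  · exact MvPolynomial.X_mem_supported.mpr (Or.inr ⟨n, rfl⟩)
  · exact MvPolynomial.supported_mono Set.subset_union_left
      (varDeriv₁_mem_xJets (kdvH_mem_xJets _) _)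

theorem kdvLagrangian_mem_supported {i j : Fin N} (hi : i ≠ 0) (hj : j ≠ 0) (hij : i ≠ j) :
    kdvLagrangian N i j ∈ MvPolynomial.supported ℝ (lagrangianJets i j) := by
  have hx : ∀ P ∈ xJets N, P ∈ MvPolynomial.supported ℝ (lagrangianJets i j) := fun P hP =>
    MvPolynomial.supported_mono (Set.subset_union_left.trans Set.subset_union_left) hP
  have hti : jetVar (idx i 1) ∈ MvPolynomial.supported ℝ (lagrangianJets i j) :=
    MvPolynomial.X_mem_supported.mpr (Or.inl (Or.inr ⟨0, by simp⟩))
  have htj : jetVar (idx j 1) ∈ MvPolynomial.supported ℝ (lagrangianJets i j) :=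
    MvPolynomial.X_mem_supported.mpr (Or.inr ⟨0, by simp⟩)
  have hai : kdvA N i j ∈ MvPolynomial.supported ℝ (lagrangianJets i j) :=
    MvPolynomial.supported_mono (Set.union_subset_union_left _ Set.subset_union_left)
      (kdvA_mem_supported i j)
  have haj : kdvA N j i ∈ MvPolynomial.supported ℝ (lagrangianJets i j) :=
    MvPolynomial.supported_mono Set.subset_union_left (kdvA_mem_supported j i)
  rw [kdvLagrangian_of_ne hi hj hij]
  exact Subalgebra.sub_mem _ (Subalgebra.add_mem _ (Subalgebra.smul_mem _ (Subalgebra.sub_mem _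
    (Subalgebra.mul_mem _ hti (hx _ (kdvG_mem_xJets _)))
    (Subalgebra.mul_mem _ htj (hx _ (kdvG_mem_xJets _)))) _) (Subalgebra.sub_mem _ hai haj))
    (Subalgebra.smul_mem _ (Subalgebra.sub_mem _ (hx _ (kdvB_mem_xJets _ _))
      (hx _ (kdvB_mem_xJets _ _))) _)

theorem pderiv_kdvA (i : Fin N) {j : Fin N} (hj : j ≠ 0) (n : ℕ) :
    MvPolynomial.pderiv (idx 0 n + idx j 1) (kdvA N i j)
      = varDeriv₁ 0 (kdvH N (i + 1)) (idx 0 (n + 1)) := by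
  obtain ⟨M, hM⟩ := exists_kdvA_eq_sum i j
  rw [hM (M + n + 1) (by omega), map_sum, Finset.sum_eq_single n]
  · rw [Derivation.leibniz, MvPolynomial.pderiv_X_self, pderiv_eq_zero_of_mem_xJets_of_ne
      (varDeriv₁_mem_xJets (kdvH_mem_xJets _) _) hj (by simp [hj.symm])]
    simp
  · intro m _ hm
    rw [Derivation.leibniz, MvPolynomial.pderiv_X_of_ne, pderiv_eq_zero_of_mem_xJets_of_ne
      (varDeriv₁_mem_xJets (kdvH_mem_xJets _) _) hj (by simp [hj.symm])]
    · simp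
    · intro h
      exact hm (Finsupp.single_injective 0 (add_right_cancel h))
  · intro h
    simp at h

theorem pderiv_kdvA_of_ne {i j : Fin N} (hi : i ≠ 0) (hij : i ≠ j) (n : ℕ) :
    MvPolynomial.pderiv (idx 0 n + idx i 1) (kdvA N i j) = 0 := by
  refine pderiv_eq_zero_of_mem_supported (kdvA_mem_supported i j) ?_
  rintro (⟨m, hm⟩ | ⟨m, hm⟩)
  · have := DFunLike.congr_fun hm i
    simp [hi.symm] at this
  · have := DFunLike.congr_fun hm i
    simp [hi.symm, hij.symm] at this

/-- The jets v_{x^n t_i} occur only in ½ v_{t_i} g_j and in -a_ji, linearly and with coefficients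
free of t-derivatives. -/
theorem pderiv_kdvLagrangian {i j : Fin N} (hi : i ≠ 0) (hj : j ≠ 0) (hij : i ≠ j) (n : ℕ) :
    MvPolynomial.pderiv (idx 0 n + idx i 1) (kdvLagrangian N i j)
      = (if n = 0 then (1 / 2 : ℝ) • kdvG N (j + 1) else 0)
        - varDeriv₁ 0 (kdvH N (j + 1)) (idx 0 (n + 1)) := by
  have hx : ∀ P ∈ xJets N, MvPolynomial.pderiv (idx 0 n + idx i 1) P = 0 := fun P hP =>
    pderiv_eq_zero_of_mem_xJets_of_ne hP hi (by simp [hi.symm])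
  have htj : MvPolynomial.pderiv (idx 0 n + idx i 1) (jetVar (idx j 1)) = 0 := by
    refine MvPolynomial.pderiv_X_of_ne fun h => ?_
    have := DFunLike.congr_fun h i
    simp [hi.symm, hij.symm] at this
  have hti : MvPolynomial.pderiv (idx 0 n + idx i 1) (jetVar (idx i 1))
      = if n = 0 then 1 else 0 := by
    split_ifs with hn
    · simp [hn, jetVar]
    · refine MvPolynomial.pderiv_X_of_ne fun h => hn ?_
      have := DFunLike.congr_fun h 0
      simpa [hi] using this.symm
  rw [kdvLagrangian_of_ne hi hj hij]
  simp only [map_sub, map_add, Derivation.map_smul, Derivation.leibniz, smul_eq_mul,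
    hx _ (kdvG_mem_xJets _), hx _ (kdvB_mem_xJets _ _), htj, hti, pderiv_kdvA j hi,
    pderiv_kdvA_of_ne hi hij]
  split_ifs <;> simp [sub_eq_add_neg]

/-- Each jet in L_ij contains at most one of t_i and t_j, and at most once, so only ∂L_ij/∂v_{t_j}
remains. It is -½ g_i from the kinetic part plus g_i from a_ij. -/
theorem varDeriv₂_kdvLagrangian {i j : Fin N} (hi : i ≠ 0) (hj : j ≠ 0) (hij : i ≠ j) :
    varDeriv₂ i j (kdvLagrangian N i j) (idx j 1) = (1 / 2 : ℝ) • kdvG N (i + 1) := by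
  rw [varDeriv₂, finsum_eq_single _ (0, 0)]
  · have h := pderiv_kdvLagrangian hj hi hij.symm 0
    rw [if_pos rfl, zero_add, varDeriv₁_kdvH hi, kdvLagrangian_swap i j, map_neg] at h
    have e : idx j 1 + idx i 0 + idx j 0 = idx 0 0 + idx j 1 := by simp
    simp only [e, Function.iterate_zero, id, add_zero, pow_zero, one_mul]
    rw [← neg_neg (MvPolynomial.pderiv _ _), h]
    module
  · rintro ⟨α, β⟩ hp
    rw [pderiv_eq_zero_of_mem_supported (kdvLagrangian_mem_supported hi hj hij),
      totalDeriv_iterate_zero, totalDeriv_iterate_zero, mul_zero]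
    rintro ((⟨n, hn⟩ | ⟨n, hn⟩) | ⟨n, hn⟩)
    · have := DFunLike.congr_fun hn j
      simp [hj.symm, hij] at this
      omega
    · have := DFunLike.congr_fun hn j
      simp [hj.symm, hij] at this
      omega
    · have h₁ := DFunLike.congr_fun hn j
      have h₂ := DFunLike.congr_fun hn i
      simp [hj.symm, hij] at h₁
      simp [hi.symm, hij.symm] at h₂
      apply hp
      simp [h₁, ← h₂]

theorem varDeriv₂_kdvLagrangian_zero {i : Fin N} (hi : i ≠ 0) :
    varDeriv₂ i 0 (kdvLagrangian N i 0) (idx 0 1)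
      = kdvG N (i + 1) - (1 / 2 : ℝ) • jetVar (idx i 1) := by
  have hpd : ∀ J : Fin N →₀ ℕ, J 0 ≠ 0 → J ≠ idx 0 1 →
      MvPolynomial.pderiv J (jetVar (idx 0 1) * jetVar (idx i 1)) = 0 := by
    intro J h₁ h₂
    rw [Derivation.leibniz, MvPolynomial.pderiv_X_of_ne, MvPolynomial.pderiv_X_of_ne h₂.symm]
    · simp
    · rintro rfl
      simp [hi] at h₁
  have hquad : varDeriv₁ 0 (jetVar (idx 0 1) * jetVar (idx i 1)) (idx 0 1)
      = jetVar (idx i 1) := by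
    rw [varDeriv₁, finsum_eq_single _ 0]
    · have hne : idx i 1 ≠ idx 0 1 := fun h => hi (Finsupp.single_left_injective one_ne_zero h)
      simp [MvPolynomial.pderiv_X_of_ne hne]
    · intro α hα
      rw [hpd, totalDeriv_iterate_zero, mul_zero]
      · simp
      · simpa using hα
  rw [kdvLagrangian_swap 0 i, varDeriv₂_neg, varDeriv₂_eq_varDeriv₁, kdvLagrangian_zero hi,
    sub_eq_add_neg, ← neg_one_smul ℝ (kdvH N (i + 1)), varDeriv₁_add,
      varDeriv₁_smul, varDeriv₁_smul,
    hquad, varDeriv₁_kdvH hi]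
  · module
  · intro α β
    rw [kdvLagrangian_zero hi, map_sub, Derivation.map_smul, hpd,
      pderiv_eq_zero_of_mem_xJets_of_ne (kdvH_mem_xJets _) hi (by simp [hi.symm]), smul_zero,
      sub_zero]
    · simp [hi]
    · intro h
      have := DFunLike.congr_fun h i
      simp [hi.symm] at this

theorem exists_ne_zero_ne (hN : 3 ≤ N) (k : Fin N) : ∃ j : Fin N, j ≠ 0 ∧ j ≠ k := by
  by_contra! h
  have h₁ := Finset.card_le_card (s := Finset.univ) (t := {0, k}) fun j _ => by
    by_cases hj : j = 0
    · simp [hj]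
    · simp [h j hj]
  have h₂ := Finset.card_le_two (a := (0 : Fin N)) (b := k)
  rw [Finset.card_univ, Fintype.card_fin] at h₁
  omega

/-- In the second family with directions t_k, t_j, x and I = 0, the two sides are ½ g_k and g_k - ½
v_{t_k}. -/
theorem exists_smul_pkdv_mem_multiTimeEL (hN : 3 ≤ N) {k : Fin N} (hk : k ≠ 0) :
    ∃ c : ℝ, c ≠ 0 ∧ c • pkdv N k ∈ multiTimeEL (kdvLagrangian N) := by
  obtain ⟨j, hj, hjk⟩ := exists_ne_zero_ne hN k
  refine ⟨1 / 2, by norm_num, Or.inl (Or.inr ⟨k, j, 0, 0, hjk.symm, hk, hj, rfl, ?_⟩)⟩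
  rw [zero_add, zero_add, varDeriv₂_kdvLagrangian hk hj hjk.symm, varDeriv₂_kdvLagrangian_zero hk,
    pkdv]
  module

end Lagrangian

/-! ### Smooth fields as a differential algebra -/

section SmoothFields

variable (N : ℕ)

/-- The algebra of smooth functions on multi-time. -/
def smoothFields : Subalgebra ℝ ((Fin N → ℝ) → ℝ) where
  carrier := {f | ContDiff ℝ ∞ f}
  mul_mem' {f g} (hf : ContDiff ℝ ∞ f) (hg : ContDiff ℝ ∞ g) := show ContDiff ℝ ∞ (f * g) from
    hf.mul hg
  add_mem' {f g} (hf : ContDiff ℝ ∞ f) (hg : ContDiff ℝ ∞ g) := show ContDiff ℝ ∞ (f + g) from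
    hf.add hg
  algebraMap_mem' c := show ContDiff ℝ ∞ (fun _ => c) from contDiff_const

variable {N}

theorem contDiff_partialDeriv (i : Fin N) {f : (Fin N → ℝ) → ℝ} (hf : ContDiff ℝ ∞ f) :
    ContDiff ℝ ∞ (partialDeriv i f) :=
  (hf.fderiv_right (m := ∞) le_rfl).clm_apply contDiff_const

theorem contDiff_smoothField (f : smoothFields N) : ContDiff ℝ ∞ (f : (Fin N → ℝ) → ℝ) := f.2

theorem differentiable_smoothField (f : smoothFields N) :
    Differentiable ℝ (f : (Fin N → ℝ) → ℝ) :=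
  (contDiff_smoothField f).differentiable (by simp)

/-- The partial derivative in the direction `t_i`, as a derivation of the smooth functions. -/
def fieldDeriv (i : Fin N) : Derivation ℝ (smoothFields N) (smoothFields N) :=
  Derivation.mk'
    { toFun := fun f => ⟨partialDeriv i f, contDiff_partialDeriv i f.2⟩
      map_add' := fun f g => by
        ext t
        change fderiv ℝ ((f : (Fin N → ℝ) → ℝ) + (g : (Fin N → ℝ) → ℝ)) t _ = _
        rw [fderiv_add (differentiable_smoothField f).differentiableAt
          (differentiable_smoothField g).differentiableAt]
        rfl
      map_smul' := fun c f => by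
        ext t
        change fderiv ℝ (c • (f : (Fin N → ℝ) → ℝ)) t _ = _
        rw [fderiv_const_smul (differentiable_smoothField f).differentiableAt]
        rfl }
    (fun f g => by
      ext t
      change fderiv ℝ ((f : (Fin N → ℝ) → ℝ) * (g : (Fin N → ℝ) → ℝ)) t _ = _
      rw [fderiv_mul (differentiable_smoothField f).differentiableAt
        (differentiable_smoothField g).differentiableAt]
      rfl)

theorem coe_fieldDeriv (i : Fin N) (f : smoothFields N) :
    (fieldDeriv i f : (Fin N → ℝ) → ℝ) = partialDeriv i f := rfl

theorem fieldDeriv_comm (i j : Fin N) (f : smoothFields N) :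
    fieldDeriv i (fieldDeriv j f) = fieldDeriv j (fieldDeriv i f) := by
  have h : ∀ (i j : Fin N) (t : Fin N → ℝ), partialDeriv i (partialDeriv j f) t
      = fderiv ℝ (fderiv ℝ (f : (Fin N → ℝ) → ℝ)) t (Pi.single i 1) (Pi.single j 1) := by
    intro i j t
    have hd : DifferentiableAt ℝ (fderiv ℝ (f : (Fin N → ℝ) → ℝ)) t :=
      (((contDiff_smoothField f).fderiv_right (m := ∞)
        le_rfl).differentiable (by simp)).differentiableAt
    unfold partialDeriv
    rw [fderiv_clm_apply hd (differentiableAt_const _)]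
    simp
  ext t
  change partialDeriv i (partialDeriv j f) t = partialDeriv j (partialDeriv i f) t
  rw [h, h]
  exact ((contDiff_smoothField f).contDiffAt.isSymmSndFDerivAt (by
    rw [minSmoothness_of_isRCLikeNormedField]
    exact WithTop.coe_le_coe.mpr le_top)).eq _ _

theorem fieldDeriv_iterate_comm (i j : Fin N) (n : ℕ) (f : smoothFields N) :
    (fieldDeriv i)^[n] (fieldDeriv j f) = fieldDeriv j ((fieldDeriv i)^[n] f) :=
  (Function.Commute.iterate_left (f := fieldDeriv i) (g := fieldDeriv j)
    (fun f => fieldDeriv_comm i j f) n).eq f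

/-- The derivative `f_I` of a smooth function. -/
def jet (f : smoothFields N) (I : Fin N →₀ ℕ) : smoothFields N :=
  (List.finRange N).foldr (fun i F => (fieldDeriv i)^[I i] F) f

theorem coe_jet (f : smoothFields N) (I : Fin N →₀ ℕ) :
    (jet f I : (Fin N → ℝ) → ℝ) = mixedPartial I f := by
  have hit : ∀ (i : Fin N) n (F : smoothFields N),
      (((fieldDeriv i)^[n] F : smoothFields N) : (Fin N → ℝ) → ℝ) = (partialDeriv i)^[n] F := by
    intro i n F
    induction n with
    | zero => rfl
    | succ n ih => rw [Function.iterate_succ_apply', Function.iterate_succ_apply',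
      coe_fieldDeriv, ih]
  rw [jet, mixedPartial]
  induction List.finRange N with
  | nil => rfl
  | cons i l ih => rw [List.foldr_cons, List.foldr_cons, hit, ih]

theorem jet_zero (f : smoothFields N) : jet f 0 = f := by
  rw [jet]
  induction List.finRange N with
  | nil => rfl
  | cons i l ih =>
    rw [List.foldr_cons, ih]
    rfl

theorem jet_add_idx (f : smoothFields N) (I : Fin N →₀ ℕ) (i : Fin N) :
    jet f (I + idx i 1) = fieldDeriv i (jet f I) := by
  -- The jet applies the partial derivatives in a fixed order, so the additional one has to be
  -- commuted outwards; without repetitions in the list it is applied only once.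
  have h : ∀ l : List (Fin N), l.Nodup →
      l.foldr (fun j F => (fieldDeriv j)^[(I + idx i 1) j] F) f
        = if i ∈ l then fieldDeriv i (l.foldr (fun j F => (fieldDeriv j)^[I j] F) f)
          else l.foldr (fun j F => (fieldDeriv j)^[I j] F) f := by
    intro l hl
    induction l with
    | nil => simp
    | cons j l ih =>
      rw [List.nodup_cons] at hl
      rw [List.foldr_cons, List.foldr_cons, ih hl.2]
      by_cases hij : i = j
      · subst hij
        rw [if_neg hl.1, if_pos (List.mem_cons_self)]
        simp [Function.iterate_succ_apply']
      · have hj : (I + idx i 1) j = I j := by simp [hij]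
        simp only [hj, List.mem_cons, hij, false_or]
        split_ifs
        · exact fieldDeriv_iterate_comm j i (I j) _
        · rfl
  rw [jet, h _ (List.nodup_finRange N), if_pos (List.mem_finRange i), jet]

theorem jet_idx_one (f : smoothFields N) (i : Fin N) : jet f (idx i 1) = fieldDeriv i f := by
  rw [← zero_add (idx i 1), jet_add_idx, jet_zero]

theorem jet_idx_add (f : smoothFields N) (i : Fin N) (n : ℕ) (I : Fin N →₀ ℕ) :
    jet f (idx i n + I) = (fieldDeriv i)^[n] (jet f I) := by
  induction n with
  | zero => simp [idx]
  | succ n ih =>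
    rw [idx, Finsupp.single_add, add_right_comm, jet_add_idx, ih, Function.iterate_succ_apply']

/-- The evaluation of differential polynomials on a smooth field. -/
def evalField (v : smoothFields N) : DiffPoly N →ₐ[ℝ] smoothFields N :=
  MvPolynomial.aeval (jet v)

theorem evalField_X (v : smoothFields N) (I : Fin N →₀ ℕ) :
    evalField v (MvPolynomial.X I) = jet v I := by
  simp [evalField]

theorem evalField_apply (v : smoothFields N) (P : DiffPoly N) (t : Fin N → ℝ) :
    (evalField v P : (Fin N → ℝ) → ℝ) t = evalOn v t P := by
  rw [evalOn]
  induction P using MvPolynomial.induction_on with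
  | C a =>
    rw [← MvPolynomial.algebraMap_eq, AlgHom.commutes, MvPolynomial.algebraMap_eq,
      MvPolynomial.eval_C]
    rfl
  | add p q hp hq =>
    rw [map_add, map_add, ← hp, ← hq]
    rfl
  | mul_X p I hp =>
    rw [map_mul, map_mul, ← hp, evalField_X, MvPolynomial.eval_X, ← coe_jet]
    rfl

theorem evalField_totalDeriv (v : smoothFields N) (i : Fin N) (P : DiffPoly N) :
    evalField v (totalDeriv i P) = fieldDeriv i (evalField v P) :=
  map_totalDeriv (fun I => by rw [evalField_X, evalField_X, jet_add_idx]) P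

/-- The first variation of `P` on the field `v`, as a smooth function. -/
def variation (v w : smoothFields N) (P : DiffPoly N) : smoothFields N :=
  contraction (evalField v) (jet w) P

theorem variation_totalDeriv (v w : smoothFields N) (i : Fin N) (P : DiffPoly N) :
    variation v w (totalDeriv i P) = fieldDeriv i (variation v w P) :=
  contraction_totalDeriv (evalField_totalDeriv v i) (fun I => jet_add_idx w I i) P

theorem smoothField_sum_apply {ι : Type*} (s : Finset ι) (f : ι → smoothFields N)
    (t : Fin N → ℝ) :
    ((∑ a ∈ s, f a : smoothFields N) : (Fin N → ℝ) → ℝ) t = ∑ a ∈ s, (f a : (Fin N → ℝ) → ℝ) t := by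
  rw [AddSubmonoidClass.coe_finsetSum, Finset.sum_apply]

theorem variation_apply (v w : smoothFields N) (P : DiffPoly N) (t : Fin N → ℝ) :
    (variation v w P : (Fin N → ℝ) → ℝ) t = firstVariation P v w t := by
  rw [variation, contraction, smoothField_sum_apply, firstVariation]
  refine Finset.sum_congr rfl fun I _ => ?_
  rw [← evalField_apply, ← coe_jet]
  rfl

theorem isSolution_iff (S : Set (DiffPoly N)) (v : smoothFields N) :
    IsSolution S v ↔ ∀ P ∈ S, evalField v P = 0 := by
  refine forall₂_congr fun P _ => ?_
  constructor
  · intro h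
    ext t
    rw [evalField_apply, h]
    rfl
  · intro h t
    rw [← evalField_apply, h]
    rfl

/-- The kernel of evaluation on a solution is an ideal closed under total derivatives and contains
S. -/
theorem evalField_eq_zero_of_mem_differentialIdeal {S : Set (DiffPoly N)} {v : smoothFields N}
    (h : IsSolution S v) {P : DiffPoly N} (hP : P ∈ differentialIdeal S) : evalField v P = 0 := by
  rw [isSolution_iff] at h
  have hle : differentialIdeal S ≤ RingHom.ker (evalField v) := by
    refine differentialIdeal_le (fun P hP => h P hP) fun i f hf => ?_
    rw [RingHom.mem_ker] at hf ⊢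
    rw [evalField_totalDeriv, hf, map_zero]
  exact hle hP

/-- Derivatives only depend on the germ of the function. -/
theorem mixedPartial_eventuallyEq {f g : (Fin N → ℝ) → ℝ} {t : Fin N → ℝ}
    (h : f =ᶠ[nhds t] g) (I : Fin N →₀ ℕ) : mixedPartial I f =ᶠ[nhds t] mixedPartial I g := by
  have hp : ∀ (i : Fin N) (f g : (Fin N → ℝ) → ℝ), f =ᶠ[nhds t] g →
      partialDeriv i f =ᶠ[nhds t] partialDeriv i g := fun i f g h => by
    filter_upwards [h.fderiv (𝕜 := ℝ)] with s hs
    rw [partialDeriv, partialDeriv, hs]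
  have hit : ∀ n (i : Fin N) (f g : (Fin N → ℝ) → ℝ), f =ᶠ[nhds t] g →
      (partialDeriv i)^[n] f =ᶠ[nhds t] (partialDeriv i)^[n] g := fun n i => by
    induction n with
    | zero => exact fun f g h => h
    | succ n ih => exact fun f g h => ih _ _ (hp i f g h)
  rw [mixedPartial, mixedPartial]
  induction List.finRange N with
  | nil => exact h
  | cons i l ih => exact hit _ i _ _ ih

theorem isSolution_multiTimeEL_iff [NeZero N] (hN : 3 ≤ N) (v : smoothFields N) :
    IsSolution (multiTimeEL (kdvLagrangian N)) v ↔ IsSolution (pkdvSystem N) v := by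
  constructor
  · intro h
    rw [isSolution_iff] at h ⊢
    rintro _ ⟨k, hk, rfl⟩
    obtain ⟨c, hc, hmem⟩ := exists_smul_pkdv_mem_multiTimeEL hN hk
    have := h _ hmem
    rw [map_smul] at this
    exact (smul_eq_zero.mp this).resolve_left hc
  · intro h
    rw [isSolution_iff]
    exact fun P hP => evalField_eq_zero_of_mem_differentialIdeal h
      (multiTimeEL_kdvLagrangian_subset hN hP)

end SmoothFields

/-! ### Two-forms on surface patches and Stokes' theorem -/

section Stokes

variable {N : ℕ}

/-- The value of an antisymmetric two-form on a pair of vectors. -/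
theorem sum_lt_mul_minor (f : Fin N → Fin N → ℝ) (hf : ∀ i j, f j i = - f i j)
    (a b : Fin N → ℝ) :
    ∑ p ∈ Finset.univ.filter (fun p : Fin N × Fin N => p.1 < p.2),
      f p.1 p.2 * (a p.1 * b p.2 - b p.1 * a p.2) = ∑ i, ∑ j, f i j * (a i * b j) := by
  have hdiag : ∀ i, f i i = 0 := fun i => by linarith [hf i i]
  have h1 : ∑ p ∈ Finset.univ.filter (fun p : Fin N × Fin N => p.1 < p.2),
      f p.1 p.2 * (b p.1 * a p.2)
      = - ∑ p ∈ Finset.univ.filter (fun p : Fin N × Fin N => p.2 < p.1),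
        f p.1 p.2 * (a p.1 * b p.2) := by
    rw [← Finset.sum_neg_distrib]
    refine Finset.sum_nbij' Prod.swap Prod.swap (by simp) (by simp) (by simp) (by simp) ?_
    intro p _
    simp only [Prod.fst_swap, Prod.snd_swap, hf p.1 p.2]
    ring
  simp only [mul_sub, Finset.sum_sub_distrib]
  rw [h1, sub_neg_eq_add, ← Finset.sum_product', Finset.univ_product_univ,
    ← Finset.sum_filter_add_sum_filter_not Finset.univ (fun p : Fin N × Fin N => p.1 < p.2)]
  congr 1
  refine Finset.sum_subset_zero_on_sdiff ?_ ?_ fun _ _ => rfl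
  · intro p hp
    simp only [Finset.mem_filter, Finset.mem_univ, true_and, not_lt] at hp ⊢
    exact hp.le
  · rintro ⟨i, j⟩ hp
    simp only [Finset.mem_sdiff, Finset.mem_filter, Finset.mem_univ, true_and, not_lt] at hp
    rw [le_antisymm hp.1 hp.2]
    simp [hdiag]

theorem mem_frontier_unitSquare {s : ℝ × ℝ} :
    s ∈ frontier (Set.Icc (0 : ℝ × ℝ) 1)
      ↔ s ∈ Set.Icc (0 : ℝ × ℝ) 1 ∧ s ∉ Set.Ioo (0 : ℝ) 1 ×ˢ Set.Ioo (0 : ℝ) 1 := by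
  rw [isClosed_Icc.frontier_eq, Set.Icc_prod_eq, interior_prod_eq, interior_Icc, interior_Icc]
  rfl

theorem fderiv_eq_sum_partialDeriv (f : (Fin N → ℝ) → ℝ) (t x : Fin N → ℝ) :
    fderiv ℝ f t x = ∑ i, x i * partialDeriv i f t := by
  conv_lhs => rw [pi_eq_sum_univ' x, map_sum]
  refine Finset.sum_congr rfl fun i _ => ?_
  rw [map_smul, smul_eq_mul]
  congr 1

/-- The second derivative of σ is kept as a separate term, symmetric in a and b, so that it drops
out of the exterior derivative of the pulled-back form. -/
theorem fderiv_pullback (θ : Fin N → smoothFields N) {σ : ℝ × ℝ → Fin N → ℝ}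
    (hσ : ContDiff ℝ ∞ σ) (a b s : ℝ × ℝ) :
    fderiv ℝ (fun s => ∑ j, (θ j : (Fin N → ℝ) → ℝ) (σ s) * fderiv ℝ σ s b j) s a
      = ∑ i, ∑ j, (fieldDeriv i (θ j) : (Fin N → ℝ) → ℝ) (σ s)
          * (fderiv ℝ σ s a i * fderiv ℝ σ s b j)
        + ∑ j, (θ j : (Fin N → ℝ) → ℝ) (σ s) * fderiv ℝ (fderiv ℝ σ) s a b j := by
  have hσd : DifferentiableAt ℝ σ s := hσ.differentiable (by simp) s
  have hσd2 : DifferentiableAt ℝ (fderiv ℝ σ) s :=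
    (hσ.fderiv_right (m := ∞) le_rfl).differentiable (by simp) s
  have h1 : ∀ j, HasFDerivAt (fun s => (θ j : (Fin N → ℝ) → ℝ) (σ s))
      ((fderiv ℝ (θ j : (Fin N → ℝ) → ℝ) (σ s)).comp (fderiv ℝ σ s)) s := fun j =>
    (differentiable_smoothField (θ j) (σ s)).hasFDerivAt.comp s hσd.hasFDerivAt
  have h2 : ∀ j, HasFDerivAt (fun s => fderiv ℝ σ s b j)
      ((ContinuousLinearMap.proj j).comp ((ContinuousLinearMap.apply ℝ _ b).comp
        (fderiv ℝ (fderiv ℝ σ) s))) s := fun j =>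
    (ContinuousLinearMap.proj (R := ℝ) (φ := fun _ : Fin N => ℝ) j).hasFDerivAt.comp s
      ((ContinuousLinearMap.apply ℝ (Fin N → ℝ) b).hasFDerivAt.comp s hσd2.hasFDerivAt)
  have h3 := HasFDerivAt.fun_sum (u := Finset.univ) fun j _ => (h1 j).mul (h2 j)
  simp only [Pi.mul_apply] at h3
  rw [h3.fderiv, Finset.sum_comm, ← Finset.sum_add_distrib]
  simp only [sum_apply]
  refine Finset.sum_congr rfl fun j _ => ?_
  simp only [add_apply, smul_apply,
    ContinuousLinearMap.comp_apply, ContinuousLinearMap.proj_apply,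
    ContinuousLinearMap.apply_apply, smul_eq_mul]
  rw [fderiv_eq_sum_partialDeriv, add_comm, Finset.mul_sum]
  congr 1
  refine Finset.sum_congr rfl fun i _ => ?_
  rw [coe_fieldDeriv]
  ring

/-- Stokes' theorem for a one-form that vanishes on the boundary of a surface patch. -/
theorem integral_extDeriv_eq_zero (θ : Fin N → smoothFields N) {σ : ℝ × ℝ → Fin N → ℝ}
    (hσ : ContDiff ℝ ∞ σ)
    (h : ∀ s ∈ frontier (Set.Icc (0 : ℝ × ℝ) 1), ∀ j, (θ j : (Fin N → ℝ) → ℝ) (σ s) = 0) :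
    ∫ s in Set.Icc (0 : ℝ × ℝ) 1, ∑ i, ∑ j,
      ((fieldDeriv i (θ j) - fieldDeriv j (θ i) : smoothFields N) : (Fin N → ℝ) → ℝ) (σ s)
        * (fderiv ℝ σ s (1, 0) i * fderiv ℝ σ s (0, 1) j) = 0 := by
  set F : ℝ × ℝ → ℝ × ℝ → ℝ := fun b s =>
    ∑ j, (θ j : (Fin N → ℝ) → ℝ) (σ s) * fderiv ℝ σ s b j with hF
  have hFc : ∀ b, ContDiff ℝ ∞ (F b) := fun b => by
    refine ContDiff.sum fun j _ => ((contDiff_smoothField (θ j)).comp hσ).mul ?_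
    exact (contDiff_apply ℝ ℝ j).comp
      ((hσ.fderiv_right (m := ∞) le_rfl).clm_apply contDiff_const)
  have hFd : ∀ b, Differentiable ℝ (F b) := fun b => (hFc b).differentiable (by simp)
  have hF' : ∀ a b, Continuous fun s => fderiv ℝ (F b) s a := fun a b =>
    ((hFc b).continuous_fderiv (by simp)).clm_apply continuous_const
  have hF0 : ∀ b, ∀ s ∈ frontier (Set.Icc (0 : ℝ × ℝ) 1), F b s = 0 := fun b s hs =>
    Finset.sum_eq_zero fun j _ => by rw [h s hs j, zero_mul]
  have key : ∀ s, ∑ i, ∑ j,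
      ((fieldDeriv i (θ j) - fieldDeriv j (θ i) : smoothFields N) : (Fin N → ℝ) → ℝ) (σ s)
        * (fderiv ℝ σ s (1, 0) i * fderiv ℝ σ s (0, 1) j)
      = fderiv ℝ (F (0, 1)) s (1, 0) + (- fderiv ℝ (F (1, 0)) s) (0, 1) := by
    intro s
    have hsymm : fderiv ℝ (fderiv ℝ σ) s (1, 0) (0, 1) = fderiv ℝ (fderiv ℝ σ) s (0, 1) (1, 0) :=
      (hσ.contDiffAt.isSymmSndFDerivAt (by
        rw [minSmoothness_of_isRCLikeNormedField]
        exact WithTop.coe_le_coe.mpr le_top)).eq _ _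
    rw [neg_apply, hF, fderiv_pullback θ hσ, fderiv_pullback θ hσ, hsymm,
      Finset.sum_comm (f := fun i j => (fieldDeriv i (θ j) : (Fin N → ℝ) → ℝ) (σ s)
          * (fderiv ℝ σ s (0, 1) i * fderiv ℝ σ s (1, 0) j)), ← sub_eq_add_neg,
      add_sub_add_right_eq_sub, ← Finset.sum_sub_distrib]
    refine Finset.sum_congr rfl fun i _ => ?_
    rw [← Finset.sum_sub_distrib]
    refine Finset.sum_congr rfl fun j _ => ?_
    change ((fieldDeriv i (θ j) : (Fin N → ℝ) → ℝ) (σ s)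
      - (fieldDeriv j (θ i) : (Fin N → ℝ) → ℝ) (σ s)) * _ = _
    ring
  simp only [key]
  -- The exterior derivative of the pulled-back one-form is the divergence of the field obtained by
  -- rotating its components.
  rw [MeasureTheory.integral_divergence_prod_Icc_of_hasFDerivAt_of_le (F (0, 1)) (-F (1, 0))
    (fun s => fderiv ℝ (F (0, 1)) s) (fun s => - fderiv ℝ (F (1, 0)) s) 0 1 zero_le_one
    (hFc _).continuous.continuousOn (hFc _).continuous.neg.continuousOn
    (fun s _ => (hFd _ s).hasFDerivAt) (fun s _ => (hFd _ s).hasFDerivAt.neg)]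
  · have e : ∀ x ∈ Set.Icc (0 : ℝ) 1, ∀ y ∈ Set.Icc (0 : ℝ) 1, (x = 0 ∨ x = 1 ∨ y = 0 ∨ y = 1) →
        (x, y) ∈ frontier (Set.Icc (0 : ℝ × ℝ) 1) := by
      intro x hx y hy hxy
      rw [mem_frontier_unitSquare]
      refine ⟨⟨⟨hx.1, hy.1⟩, ⟨hx.2, hy.2⟩⟩, fun ⟨h1, h2⟩ => ?_⟩
      simp only at h1 h2
      rcases hxy with rfl | rfl | rfl | rfl
      · exact h1.1.false
      · exact h1.2.false
      · exact h2.1.false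
      · exact h2.2.false
    have hz : ∀ f : ℝ → ℝ, (∀ x ∈ Set.Icc (0 : ℝ) 1, f x = 0) → ∫ x in (0 : ℝ)..1, f x = 0 := by
      intro f hf
      rw [intervalIntegral.integral_congr (g := fun _ => 0)]
      · simp
      · intro x hx
        rw [Set.uIcc_of_le zero_le_one] at hx
        exact hf x hx
    have h0 : (0 : ℝ) ∈ Set.Icc (0 : ℝ) 1 := ⟨le_rfl, zero_le_one⟩
    have h1 : (1 : ℝ) ∈ Set.Icc (0 : ℝ) 1 := ⟨zero_le_one, le_rfl⟩
    simp only [Prod.fst_zero, Prod.fst_one, Prod.snd_zero, Prod.snd_one, Pi.neg_apply]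
    rw [hz, hz, hz, hz]
    · simp
    · exact fun x hx => hF0 _ _ (e _ h0 x hx (by simp))
    · exact fun x hx => hF0 _ _ (e _ h1 x hx (by simp))
    · exact fun x hx => neg_eq_zero.mpr (hF0 _ _ (e x hx _ h0 (by simp)))
    · exact fun x hx => neg_eq_zero.mpr (hF0 _ _ (e x hx _ h1 (by simp)))
  · exact ((hF' _ _).add (hF' _ _).neg).continuousOn.integrableOn_compact isCompact_Icc

end Stokes

/-! ### Solutions of the PKdV equations are critical -/

section Critical

variable {N : ℕ}

theorem jet_zero_field (I : Fin N →₀ ℕ) : jet (0 : smoothFields N) I = 0 := by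
  have hit : ∀ (i : Fin N) n, (fieldDeriv i)^[n] (0 : smoothFields N) = 0 := fun i n => by
    induction n with
    | zero => rfl
    | succ n ih => rw [Function.iterate_succ_apply', ih, map_zero]
  rw [jet]
  induction List.finRange N with
  | nil => rfl
  | cons i l ih => rw [List.foldr_cons, ih, hit]

theorem jet_apply_eq_of_eqOn {f g : smoothFields N} {U : Set (Fin N → ℝ)} (hU : IsOpen U)
    (h : ∀ s ∈ U, (f : (Fin N → ℝ) → ℝ) s = (g : (Fin N → ℝ) → ℝ) s) {t : Fin N → ℝ} (ht : t ∈ U)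
    (I : Fin N →₀ ℕ) : (jet f I : (Fin N → ℝ) → ℝ) t = (jet g I : (Fin N → ℝ) → ℝ) t := by
  rw [coe_jet, coe_jet]
  refine (mixedPartial_eventuallyEq ?_ I).eq_of_nhds
  filter_upwards [hU.mem_nhds ht] with s hs using h s hs

theorem fieldDeriv_apply_eq_of_eqOn {f g : smoothFields N} {U : Set (Fin N → ℝ)} (hU : IsOpen U)
    (h : ∀ s ∈ U, (f : (Fin N → ℝ) → ℝ) s = (g : (Fin N → ℝ) → ℝ) s) {t : Fin N → ℝ} (ht : t ∈ U)
    (i : Fin N) :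
    (fieldDeriv i f : (Fin N → ℝ) → ℝ) t = (fieldDeriv i g : (Fin N → ℝ) → ℝ) t := by
  rw [← jet_idx_one, ← jet_idx_one]
  exact jet_apply_eq_of_eqOn hU h ht _

theorem variation_neg (v w : smoothFields N) (P : DiffPoly N) :
    variation v w (-P) = - variation v w P := contraction_neg _ _ _

/-- The action on a surface, written with the full antisymmetric family `L`. -/
theorem actionVariation_eq {L : Fin N → Fin N → DiffPoly N} (hL : ∀ i j, L j i = - L i j)
    (v w : smoothFields N) (σ : ℝ × ℝ → Fin N → ℝ) :
    actionVariation L v w σ = ∫ s in Set.Icc (0 : ℝ × ℝ) 1, ∑ i, ∑ j,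
      (variation v w (L i j) : (Fin N → ℝ) → ℝ) (σ s)
        * (fderiv ℝ σ s (1, 0) i * fderiv ℝ σ s (0, 1) j) := by
  rw [actionVariation]
  congr 1
  funext s
  simp only [← variation_apply]
  refine sum_lt_mul_minor (fun i j => (variation v w (L i j) : (Fin N → ℝ) → ℝ) (σ s)) ?_ _ _
  intro i j
  simp only [hL i j, variation_neg]
  rfl

variable [NeZero N]

/-- The one-form with `δL = dθ` on solutions of the PKdV equations. -/
def boundaryForm (v w : smoothFields N) (i : Fin N) : smoothFields N :=
  if i = 0 then - (1 / 2 : ℝ) • (fieldDeriv 0 v * w)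
  else (1 / 2 : ℝ) • (fieldDeriv i v * w)
    - ∑ᶠ n : ℕ, jet w (idx 0 n) * evalField v (varDeriv₁ 0 (kdvH N (i + 1)) (idx 0 (n + 1)))

theorem boundaryForm_apply_eq_of_eqOn (v : smoothFields N) {w w' : smoothFields N}
    {U : Set (Fin N → ℝ)} (hU : IsOpen U)
    (h : ∀ s ∈ U, (w : (Fin N → ℝ) → ℝ) s = (w' : (Fin N → ℝ) → ℝ) s) {t : Fin N → ℝ} (ht : t ∈ U)
    (i : Fin N) :
    (boundaryForm v w i : (Fin N → ℝ) → ℝ) t = (boundaryForm v w' i : (Fin N → ℝ) → ℝ) t := by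
  obtain ⟨M, hM⟩ := exists_varDeriv₁_eq_zero 0 (kdvH N (i + 1))
  have hs : ∀ w : smoothFields N, ∑ᶠ n : ℕ, jet w (idx 0 n)
      * evalField v (varDeriv₁ 0 (kdvH N (i + 1)) (idx 0 (n + 1)))
      = ∑ n ∈ Finset.range M, jet w (idx 0 n)
        * evalField v (varDeriv₁ 0 (kdvH N (i + 1)) (idx 0 (n + 1))) := fun w =>
    finsum_eq_sum_range_of_vanishesFrom fun n hn => by
      rw [hM, map_zero, mul_zero]
      simp
      omega
  have hsum : ((∑ n ∈ Finset.range M, jet w (idx 0 n)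
        * evalField v (varDeriv₁ 0 (kdvH N (i + 1)) (idx 0 (n + 1))) : smoothFields N) :
        (Fin N → ℝ) → ℝ) t
      = ((∑ n ∈ Finset.range M, jet w' (idx 0 n)
        * evalField v (varDeriv₁ 0 (kdvH N (i + 1)) (idx 0 (n + 1))) : smoothFields N) :
        (Fin N → ℝ) → ℝ) t := by
    rw [smoothField_sum_apply, smoothField_sum_apply]
    refine Finset.sum_congr rfl fun n _ => ?_
    change (jet w (idx 0 n) : (Fin N → ℝ) → ℝ) t * _ = (jet w' (idx 0 n) : (Fin N → ℝ) → ℝ) t * _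
    rw [jet_apply_eq_of_eqOn hU h ht]
  rw [boundaryForm, boundaryForm, hs, hs]
  split_ifs
  · change -(1 / 2 : ℝ) * (_ * (w : (Fin N → ℝ) → ℝ) t)
      = -(1 / 2 : ℝ) * (_ * (w' : (Fin N → ℝ) → ℝ) t)
    rw [h t ht]
  · change (1 / 2 : ℝ) * (_ * (w : (Fin N → ℝ) → ℝ) t) - _
      = (1 / 2 : ℝ) * (_ * (w' : (Fin N → ℝ) → ℝ) t) - _
    rw [h t ht, hsum]

theorem boundaryForm_zero (v : smoothFields N) (i : Fin N) : boundaryForm v 0 i = 0 := by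
  simp [boundaryForm, jet_zero_field]

/-- The variation of `L_(1i)`. -/
theorem variation_kdvLagrangian_zero (v w : smoothFields N) {i : Fin N} (hi : i ≠ 0) :
    variation v w (kdvLagrangian N 0 i)
      = fieldDeriv 0 (boundaryForm v w i) - fieldDeriv i (boundaryForm v w 0)
        - fieldDeriv 0 (evalField v (pkdv N i)) * w := by
  have hh := contraction_kdvH (evalField_totalDeriv v 0) (fun I => jet_add_idx w I 0) hi (i + 1)
  have hE : evalField v (pkdv N i) = fieldDeriv i v - evalField v (kdvG N (i + 1)) := by
    rw [pkdv, map_sub, evalField_X, jet_idx_one]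
  rw [kdvLagrangian_zero hi, variation, contraction_sub, contraction_smul, contraction_mul, hh,
    contraction_X, contraction_X, evalField_X, evalField_X, jet_idx_one, jet_idx_one, jet_idx_one,
    jet_idx_one, jet_zero, boundaryForm, boundaryForm, if_neg hi, if_pos rfl, hE]
  simp only [map_sub, Derivation.map_smul, Derivation.leibniz, smul_eq_mul, fieldDeriv_comm i 0]
  have h2 : (1 / 2 : ℝ) • (w * fieldDeriv 0 (fieldDeriv i v))
      + (1 / 2 : ℝ) • (w * fieldDeriv 0 (fieldDeriv i v)) = w * fieldDeriv 0 (fieldDeriv i v) := by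
    module
  simp only [smul_add, neg_smul]
  linear_combination -h2

/-- The difference between `δL` and `dθ`. -/
def defectForm (v w : smoothFields N) (i j : Fin N) : smoothFields N :=
  variation v w (kdvLagrangian N i j)
    - (fieldDeriv i (boundaryForm v w j) - fieldDeriv j (boundaryForm v w i))

theorem defectForm_swap (v w : smoothFields N) (i j : Fin N) :
    defectForm v w j i = - defectForm v w i j := by
  rw [defectForm, defectForm, kdvLagrangian_swap i j, variation_neg]
  ring

theorem defectForm_zero_field (v : smoothFields N) (i j : Fin N) : defectForm v 0 i j = 0 := by
  simp [defectForm, variation, contraction, boundaryForm_zero, jet_zero_field]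

/-- Locality: the defect is a differential expression in w, so w may be cut off away from the point
considered. -/
theorem defectForm_apply_eq_of_eqOn (v : smoothFields N) {w w' : smoothFields N}
    {U : Set (Fin N → ℝ)} (hU : IsOpen U)
    (h : ∀ s ∈ U, (w : (Fin N → ℝ) → ℝ) s = (w' : (Fin N → ℝ) → ℝ) s) {t : Fin N → ℝ} (ht : t ∈ U)
    (i j : Fin N) :
    (defectForm v w i j : (Fin N → ℝ) → ℝ) t = (defectForm v w' i j : (Fin N → ℝ) → ℝ) t := by
  have h1 : (variation v w (kdvLagrangian N i j) : (Fin N → ℝ) → ℝ) t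
      = (variation v w' (kdvLagrangian N i j) : (Fin N → ℝ) → ℝ) t := by
    rw [variation, contraction, variation, contraction, smoothField_sum_apply,
      smoothField_sum_apply]
    refine Finset.sum_congr rfl fun I _ => ?_
    change _ * (jet w I : (Fin N → ℝ) → ℝ) t = _ * (jet w' I : (Fin N → ℝ) → ℝ) t
    rw [jet_apply_eq_of_eqOn hU h ht]
  have h2 : ∀ i j, (fieldDeriv i (boundaryForm v w j) : (Fin N → ℝ) → ℝ) t
      = (fieldDeriv i (boundaryForm v w' j) : (Fin N → ℝ) → ℝ) t := fun i j =>
    fieldDeriv_apply_eq_of_eqOn hU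
      (fun s hs => boundaryForm_apply_eq_of_eqOn v hU h hs j) ht i
  change (variation v w _ : (Fin N → ℝ) → ℝ) t - ((fieldDeriv i (boundaryForm v w j) :
      (Fin N → ℝ) → ℝ) t - (fieldDeriv j (boundaryForm v w i) : (Fin N → ℝ) → ℝ) t)
    = (variation v w' _ : (Fin N → ℝ) → ℝ) t - ((fieldDeriv i (boundaryForm v w' j) :
      (Fin N → ℝ) → ℝ) t - (fieldDeriv j (boundaryForm v w' i) : (Fin N → ℝ) → ℝ) t)
  rw [h1, h2, h2]

theorem defectForm_zero {v : smoothFields N} (hv : IsSolution (pkdvSystem N) v)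
    (w : smoothFields N) {i : Fin N} (hi : i ≠ 0) : defectForm v w 0 i = 0 := by
  have hE : evalField v (pkdv N i) = 0 := (isSolution_iff _ _).mp hv _ ⟨i, hi, rfl⟩
  rw [defectForm, variation_kdvLagrangian_zero v w hi, hE, map_zero, zero_mul]
  ring

/-- On solutions dL has a double zero, so d(δL) = δ(dL) = 0, and d(dθ) = 0. The defect is therefore
closed, and since its dx-components vanish, closedness reduces to constancy along x. -/
theorem fieldDeriv_defectForm {v : smoothFields N} (hv : IsSolution (pkdvSystem N) v)
    (w : smoothFields N) {i j : Fin N} (hi : i ≠ 0) (hj : j ≠ 0) (hij : i ≠ j) :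
    fieldDeriv 0 (defectForm v w i j) = 0 := by
  have h0 : variation v w (extCoeff (kdvLagrangian N) 0 i j) = 0 := by
    refine Finset.sum_eq_zero fun I _ => ?_
    rw [evalField_eq_zero_of_mem_differentialIdeal hv
      (pderiv_extCoeff_mem hi.symm hj.symm hij I), zero_mul]
  have hi0 := sub_eq_zero.mp (defectForm_zero hv w hi)
  have hj0 := sub_eq_zero.mp (defectForm_zero hv w hj)
  rw [extCoeff, kdvLagrangian_swap 0 j] at h0
  have h1 : variation v w (totalDeriv 0 (kdvLagrangian N i j)
      + totalDeriv i (-kdvLagrangian N 0 j) + totalDeriv j (kdvLagrangian N 0 i))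
      = variation v w (totalDeriv 0 (kdvLagrangian N i j))
        + variation v w (totalDeriv i (-kdvLagrangian N 0 j))
        + variation v w (totalDeriv j (kdvLagrangian N 0 i)) := by
    rw [variation, contraction_add, contraction_add]
    rfl
  rw [h1, variation_totalDeriv, variation_totalDeriv, variation_totalDeriv, variation_neg, hi0,
    hj0] at h0
  rw [defectForm]
  simp only [map_sub, map_neg, fieldDeriv_comm i 0, fieldDeriv_comm j 0,
    fieldDeriv_comm j i] at h0 ⊢
  linear_combination h0

/-- Away from the diagonal and the dx-components, replace w by a compactly supported function with
the same germ at t. The defect is constant along the x-line through t and vanishes where the new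
variation does. -/
theorem defectForm_eq_zero {v : smoothFields N} (hv : IsSolution (pkdvSystem N) v)
    (w : smoothFields N) (i j : Fin N) : defectForm v w i j = 0 := by
  by_cases hij : i = j
  · subst hij
    have h := defectForm_swap v w i i
    ext t
    have ht := congrArg (fun f : smoothFields N => (f : (Fin N → ℝ) → ℝ) t) h
    change (defectForm v w i i : (Fin N → ℝ) → ℝ) t
      = - (defectForm v w i i : (Fin N → ℝ) → ℝ) t at ht
    change _ = (0 : ℝ)
    linarith
  by_cases hi : i = 0
  · subst hi
    exact defectForm_zero hv w (Ne.symm hij)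
  by_cases hj : j = 0
  · subst hj
    rw [defectForm_swap, defectForm_zero hv w hi, neg_zero]
  ext t
  let χ : ContDiffBump t := ⟨1, 2, one_pos, one_lt_two⟩
  let w' : smoothFields N := ⟨χ, χ.contDiff⟩ * w
  have hw' : ∀ s, (w' : (Fin N → ℝ) → ℝ) s = χ s * (w : (Fin N → ℝ) → ℝ) s := fun s => rfl
  have h1 : (defectForm v w i j : (Fin N → ℝ) → ℝ) t
      = (defectForm v w' i j : (Fin N → ℝ) → ℝ) t := by
    refine defectForm_apply_eq_of_eqOn v Metric.isOpen_ball (fun s hs => ?_)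
      (Metric.mem_ball_self one_pos) i j
    rw [hw', χ.one_of_mem_closedBall (Metric.ball_subset_closedBall hs), one_mul]
  let γ : ℝ → Fin N → ℝ := fun c => t + c • Pi.single 0 1
  have hγ : ∀ c, HasDerivAt γ (Pi.single 0 1) c := fun c => by
    have := ((hasDerivAt_id c).smul_const (Pi.single (0 : Fin N) (1 : ℝ))).const_add t
    rwa [one_smul] at this
  have h2 : ∀ c, HasDerivAt (fun c => (defectForm v w' i j : (Fin N → ℝ) → ℝ) (γ c)) 0 c := by
    intro c
    have h := (differentiable_smoothField (defectForm v w' i j) (γ c)).hasFDerivAt.comp_hasDerivAt c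
      (hγ c)
    have h0 : (fieldDeriv 0 (defectForm v w' i j) : (Fin N → ℝ) → ℝ) (γ c) = 0 := by
      rw [fieldDeriv_defectForm hv w' hi hj hij]
      rfl
    rw [coe_fieldDeriv, partialDeriv] at h0
    rw [h0] at h
    exact h
  -- The cut-off vanishes at distance at least 2 from t, so at parameter 4 a whole unit ball misses
  -- its support.
  have h3 := is_const_of_deriv_eq_zero (fun c => (h2 c).differentiableAt)
    (fun c => (h2 c).deriv) 0 4
  have h4 : (defectForm v w' i j : (Fin N → ℝ) → ℝ) (γ 4) = 0 := by
    rw [defectForm_apply_eq_of_eqOn v (w' := 0) Metric.isOpen_ball (fun s hs => ?_)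
      (Metric.mem_ball_self one_pos) i j, defectForm_zero_field]
    · rfl
    · rw [hw', χ.zero_of_le_dist, zero_mul]
      · rfl
      · have hd : dist (γ 4) t = 4 := by
          simp [γ, dist_eq_norm, norm_smul, Pi.norm_single]
        have h5 := dist_triangle (γ 4) s t
        rw [Metric.mem_ball, dist_comm] at hs
        change (2 : ℝ) ≤ _
        linarith
  rw [h1]
  have hγ0 : γ 0 = t := by simp [γ]
  rw [← hγ0]
  exact h3.trans h4

/-- On a solution δL = dθ, and θ vanishes wherever w vanishes locally, in particular along the
boundary. -/
theorem solvesPluriLagrangian_of_isSolution {v : smoothFields N}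
    (hv : IsSolution (pkdvSystem N) v) : SolvesPluriLagrangian (kdvLagrangian N) v := by
  intro σ hσ w hw hsupp
  lift w to smoothFields N using hw
  rw [actionVariation_eq kdvLagrangian_swap]
  have h : ∀ i j, variation v w (kdvLagrangian N i j)
      = fieldDeriv i (boundaryForm v w j) - fieldDeriv j (boundaryForm v w i) := fun i j =>
    sub_eq_zero.mp (defectForm_eq_zero hv w i j)
  simp only [h]
  refine integral_extDeriv_eq_zero _ hσ.1 fun s hs j => ?_
  rw [boundaryForm_apply_eq_of_eqOn v (w' := 0) (isClosed_tsupport _).isOpen_compl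
    (fun t ht => ?_) (hsupp s hs), boundaryForm_zero]
  · rfl
  · exact image_eq_zero_of_notMem_tsupport ht

end Critical

/-! ### First variation on a tilted plane -/

section PlanarVariation

variable {N : ℕ} [NeZero N]

theorem jet_eq_zero_of_fieldDeriv_zero {w φ : smoothFields N} (hw : fieldDeriv 0 w = φ)
    (hφ : fieldDeriv 0 φ = 0) (n : ℕ) : jet w (idx 0 (n + 2)) = 0 := by
  have h : fieldDeriv 0 (fieldDeriv 0 w) = 0 := by rw [hw, hφ]
  rw [← add_zero (idx 0 (n + 2)), jet_idx_add, jet_zero, Function.iterate_add_apply]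
  induction n with
  | zero => exact h
  | succ n ih => rw [Function.iterate_succ_apply', ih, map_zero]

/-- The variation of `L` in a plane that contains the direction `t_k` and is transverse to `x`, for
a variation that vanishes on the plane. -/
theorem exists_variation_plane {j k : Fin N} (hj : j ≠ 0) (hk : k ≠ 0) (hjk : j ≠ k)
    (v : smoothFields N) {l φ : smoothFields N} {r : ℝ} (h0 : fieldDeriv 0 l = 1)
    (hl : fieldDeriv j l = - algebraMap ℝ _ r) (hlk : fieldDeriv k l = 0)
    (hφ : fieldDeriv 0 φ = 0) (cj ck : smoothFields N)
    (hcj : cj = evalField v (varDeriv₁ 0 (kdvH N (j + 1)) (idx 0 2)))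
    (hck : ck = evalField v (varDeriv₁ 0 (kdvH N (k + 1)) (idx 0 2))) :
    ∃ z, variation v (l * φ) (kdvLagrangian N j k)
        + algebraMap ℝ _ r * variation v (l * φ) (kdvLagrangian N 0 k)
      = (fieldDeriv j (-(φ * ck)) - fieldDeriv k (-(φ * cj)))
        + algebraMap ℝ _ r * fieldDeriv 0 (-(φ * ck))
        + φ * ((evalField v (MvPolynomial.pderiv (idx 0 1) (kdvLagrangian N j k))
            + fieldDeriv j ck - fieldDeriv k cj)
          + algebraMap ℝ _ (r / 2) * evalField v (pkdv N k)) + l * z := by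
  set w := l * φ with hw
  have hw0 : fieldDeriv 0 w = φ := by
    rw [hw, Derivation.leibniz, h0, hφ, smul_zero, zero_add, smul_eq_mul, mul_one]
  have hwj : fieldDeriv j w = l * fieldDeriv j φ - algebraMap ℝ _ r * φ := by
    rw [hw, Derivation.leibniz, hl, smul_eq_mul, smul_eq_mul]
    ring
  have hwk : fieldDeriv k w = l * fieldDeriv k φ := by
    rw [hw, Derivation.leibniz, hlk, smul_zero, add_zero, smul_eq_mul]
  have hj1 : ∀ i, jet w (idx 0 1 + idx i 1) = fieldDeriv i φ := fun i => by
    rw [jet_add_idx, jet_idx_one, hw0]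
  have hj0 : ∀ i, jet w (idx 0 0 + idx i 1) = fieldDeriv i w := fun i => by
    rw [idx, Finsupp.single_zero, zero_add, jet_idx_one]
  have hhigh := jet_eq_zero_of_fieldDeriv_zero hw0 hφ
  have hhigh' : ∀ n i, jet w (idx 0 (n + 2) + idx i 1) = 0 := fun n i => by
    rw [jet_add_idx, hhigh, map_zero]
  have hjk' : variation v w (kdvLagrangian N j k)
      = evalField v (MvPolynomial.pderiv (idx 0 1) (kdvLagrangian N j k)) * φ
        - (1 / 2 : ℝ) • evalField v (kdvG N (k + 1)) * fieldDeriv j w - ck * fieldDeriv j φ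
        + (1 / 2 : ℝ) • evalField v (kdvG N (j + 1)) * fieldDeriv k w + cj * fieldDeriv k φ := by
    have d1 := pderiv_kdvLagrangian hj hk hjk 0
    have d2 := pderiv_kdvLagrangian hj hk hjk 1
    have d3 := pderiv_kdvLagrangian hk hj hjk.symm 0
    have d4 := pderiv_kdvLagrangian hk hj hjk.symm 1
    rw [if_pos rfl, zero_add, varDeriv₁_kdvH hj] at d1 d3
    rw [if_neg one_ne_zero, zero_sub] at d2 d4
    rw [kdvLagrangian_swap j k, map_neg, neg_eq_iff_eq_neg] at d3 d4
    -- Since w_xx = 0, only these five jets of L_jk meet a possibly non-zero derivative of w.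
    rw [variation, contraction_eq_sum (S := {idx 0 1, idx 0 0 + idx j 1, idx 0 1 + idx j 1,
      idx 0 0 + idx k 1, idx 0 1 + idx k 1})]
    -- The five multi-indices are told apart by their orders in x, t_j and t_k.
    · have hne : ∀ I J : Fin N →₀ ℕ, (I 0, I j, I k) ≠ (J 0, J j, J k) → I ≠ J := by
        rintro I _ h rfl
        exact h rfl
      rw [Finset.sum_insert, Finset.sum_insert, Finset.sum_insert, Finset.sum_insert,
        Finset.sum_singleton]
      · rw [d1, d2, d3, d4, hj0, hj0, hj1, hj1, jet_idx_one, hw0, hcj, hck]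
        simp only [map_sub, map_neg, map_smul]
        have hg : ∀ f : smoothFields N, (1 / 2 : ℝ) • f - f = - ((1 / 2 : ℝ) • f) := fun f => by
          module
        rw [hg, hg]
        ring
      all_goals
        simp only [Finset.mem_insert, Finset.mem_singleton, not_or]
        and_intros
        all_goals exact hne _ _ (by simp [hj, hk, hjk, hj.symm, hk.symm, hjk.symm])
    · intro I hI
      by_cases h : I ∈ lagrangianJets j k
      · rw [Finset.mem_insert, Finset.mem_insert, Finset.mem_insert, Finset.mem_insert,
          Finset.mem_singleton] at hI
        push Not at hI
        have hjet : jet w I = 0 := by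
          rcases h with (⟨n, rfl⟩ | ⟨n, rfl⟩) | ⟨n, rfl⟩
          · cases n with
            | zero => exact absurd rfl hI.1
            | succ n => exact hhigh n
          · match n with
            | 0 => exact absurd rfl hI.2.1
            | 1 => exact absurd rfl hI.2.2.1
            | n + 2 => exact hhigh' n j
          · match n with
            | 0 => exact absurd rfl hI.2.2.2.1
            | 1 => exact absurd rfl hI.2.2.2.2
            | n + 2 => exact hhigh' n k
        rw [hjet, mul_zero]
      · rw [pderiv_eq_zero_of_mem_supported (kdvLagrangian_mem_supported hj hk hjk) h, map_zero,
          zero_mul]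
  have h0k : variation v w (kdvLagrangian N 0 k)
      = (1 / 2 : ℝ) • (fieldDeriv 0 v * fieldDeriv k w + fieldDeriv k v * φ)
        - (evalField v (kdvG N (k + 1)) + fieldDeriv 0 ck) * φ := by
    have hh : contraction (evalField v) (jet w) (kdvH N (k + 1))
        = (evalField v (kdvG N (k + 1)) + fieldDeriv 0 ck) * φ := by
      rw [contraction_eq_sum (S := {idx 0 1}), Finset.sum_singleton, pderiv_eq_varDeriv₁_add 0,
        varDeriv₁_kdvH hk, map_add, evalField_totalDeriv, ← Finsupp.single_add, hck, jet_idx_one,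
        hw0]
      intro I hI
      by_cases h : ∃ n, I = idx 0 (n + 1)
      · obtain ⟨n, rfl⟩ := h
        cases n with
        | zero => simp at hI
        | succ n => rw [hhigh, mul_zero]
      · rw [pderiv_eq_zero_of_mem_xJets (kdvH_mem_xJets _) (not_exists.mp h), map_zero, zero_mul]
    rw [kdvLagrangian_zero hk, variation, contraction_sub, contraction_smul, contraction_mul, hh,
      contraction_X, contraction_X, evalField_X, evalField_X, jet_idx_one, jet_idx_one, jet_idx_one,
      jet_idx_one, hw0]
  have hE : evalField v (pkdv N k) = fieldDeriv k v - evalField v (kdvG N (k + 1)) := by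
    rw [pkdv, map_sub, evalField_X, jet_idx_one]
  -- The witness collects the terms with a factor l, which vanishes on the plane. In the rest,
  -- w_{t_j} = -rφ contributes (r/2) g_k φ, which joins r(½ v_{t_k} - g_k)φ from L_1k to give (r/2)
  -- E_k φ.
  refine ⟨- (1 / 2 : ℝ) • evalField v (kdvG N (k + 1)) * fieldDeriv j φ
    + (1 / 2 : ℝ) • evalField v (kdvG N (j + 1)) * fieldDeriv k φ
    + algebraMap ℝ _ (r / 2) * (fieldDeriv 0 v * fieldDeriv k φ), ?_⟩
  have hc : ∀ f : smoothFields N, (1 / 2 : ℝ) • f = algebraMap ℝ _ (1 / 2) * f := fun f =>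
    Algebra.smul_def _ _
  have hr : algebraMap ℝ (smoothFields N) (r / 2) = algebraMap ℝ _ (1 / 2) * algebraMap ℝ _ r := by
    rw [← map_mul]
    congr 1
    ring
  have h1 : 2 * algebraMap ℝ (smoothFields N) (1 / 2) = 1 := by
    rw [← map_ofNat (algebraMap ℝ (smoothFields N)) 2, ← map_mul]
    norm_num
  rw [hjk', h0k, hE, hwj, hwk]
  simp only [map_neg, Derivation.leibniz, smul_eq_mul, hφ, hc, neg_smul, hr]
  linear_combination (algebraMap ℝ (smoothFields N) r * φ * evalField v (kdvG N (k + 1))) * h1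

end PlanarVariation

/-! ### Plane surface patches -/

section PlanarPatch

variable {N : ℕ}

/-- The plane patch centred at `t` that is spanned by `a` and `b`. -/
def planePatch (t a b : Fin N → ℝ) (s : ℝ × ℝ) : Fin N → ℝ :=
  t + ((s.1 - 1 / 2) • a + (s.2 - 1 / 2) • b)

theorem hasFDerivAt_planePatch (t a b : Fin N → ℝ) (s : ℝ × ℝ) :
    HasFDerivAt (planePatch t a b) ((ContinuousLinearMap.fst ℝ ℝ ℝ).smulRight a
      + (ContinuousLinearMap.snd ℝ ℝ ℝ).smulRight b) s := by
  have h1 := ((hasFDerivAt_fst (𝕜 := ℝ) (p := s)).sub_const (1 / 2)).smul_const a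
  have h2 := ((hasFDerivAt_snd (𝕜 := ℝ) (p := s)).sub_const (1 / 2)).smul_const b
  exact (h1.add h2).const_add t

theorem fderiv_planePatch (t a b : Fin N → ℝ) (s x : ℝ × ℝ) :
    fderiv ℝ (planePatch t a b) s x = x.1 • a + x.2 • b := by
  rw [(hasFDerivAt_planePatch t a b s).fderiv]
  rfl

theorem contDiff_planePatch (t a b : Fin N → ℝ) : ContDiff ℝ ∞ (planePatch t a b) := by
  unfold planePatch
  fun_prop

theorem isSurfacePatch_planePatch (t : Fin N → ℝ) {a b : Fin N → ℝ}
    (h : ∀ x y : ℝ, x • a + y • b = 0 → x = 0 ∧ y = 0) : IsSurfacePatch (planePatch t a b) := by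
  refine ⟨contDiff_planePatch t a b, fun s _ s' _ hs => ?_, fun s _ => ?_⟩
  · have h1 : (s.1 - s'.1) • a + (s.2 - s'.2) • b = 0 := by
      have := add_left_cancel hs
      rw [← sub_eq_zero] at this
      rw [← this]
      module
    have h2 := h _ _ h1
    exact Prod.ext (sub_eq_zero.mp h2.1) (sub_eq_zero.mp h2.2)
  · rw [injective_iff_map_eq_zero]
    intro x hx
    rw [fderiv_planePatch] at hx
    exact Prod.ext (h _ _ hx).1 (h _ _ hx).2

theorem sum_sum_mul_single {i j k : Fin N} (f : Fin N → Fin N → ℝ) (r : ℝ) :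
    ∑ a, ∑ b, f a b * ((Pi.single j 1 + r • Pi.single i 1 : Fin N → ℝ) a
      * (Pi.single k 1 : Fin N → ℝ) b) = f j k + r * f i k := by
  simp only [Pi.add_apply, Pi.smul_apply, smul_eq_mul, Pi.single_apply, mul_ite, mul_one, mul_zero,
    Finset.sum_ite_eq', Finset.mem_univ, if_true, mul_add, Finset.sum_add_distrib]
  ring

end PlanarPatch

/-! ### Critical fields satisfy the PKdV equations -/

section Necessity

variable {N : ℕ} [NeZero N]

/-- Criticality is tested with w = lφ, where l vanishes on the plane, has x-derivative 1, and φ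
extends g constantly along x. The exact part integrates to zero by Stokes' theorem. -/
theorem integral_eq_zero_of_solvesPluriLagrangian {v : smoothFields N}
    (hv : SolvesPluriLagrangian (kdvLagrangian N) v) {j k : Fin N} (hj : j ≠ 0) (hk : k ≠ 0)
    (hjk : j ≠ k) (t : Fin N → ℝ) (r : ℝ) (g : ℝ × ℝ → ℝ) (hg : ContDiff ℝ ∞ g)
    (hgs : tsupport g ⊆ Set.Ioo (0 : ℝ) 1 ×ˢ Set.Ioo (0 : ℝ) 1) (X : smoothFields N)
    (hX : X = evalField v (MvPolynomial.pderiv (idx 0 1) (kdvLagrangian N j k))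
      + fieldDeriv j (evalField v (varDeriv₁ 0 (kdvH N (k + 1)) (idx 0 2)))
      - fieldDeriv k (evalField v (varDeriv₁ 0 (kdvH N (j + 1)) (idx 0 2)))) :
    ∫ s in Set.Icc (0 : ℝ × ℝ) 1, g s *
      ((X + algebraMap ℝ _ (r / 2) * evalField v (pkdv N k) : smoothFields N) : (Fin N → ℝ) → ℝ)
        (planePatch t (Pi.single j 1 + r • Pi.single 0 1) (Pi.single k 1) s) = 0 := by
  set σ := planePatch t (Pi.single j 1 + r • Pi.single 0 1) (Pi.single k 1) with hσdef
  have hσc : ContDiff ℝ ∞ σ := contDiff_planePatch _ _ _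
  have hσ : IsSurfacePatch σ := by
    refine isSurfacePatch_planePatch t fun x y h => ⟨?_, ?_⟩
    · simpa [hj, hjk] using congrFun h j
    · simpa [hk, hjk.symm] using congrFun h k
  have hσj : ∀ s, σ s j = t j + (s.1 - 1 / 2) := fun s => by
    simp [hσdef, planePatch, hj, hjk]
  have hσk : ∀ s, σ s k = t k + (s.2 - 1 / 2) := fun s => by
    simp [hσdef, planePatch, hk, hjk.symm]
  have hσ0 : ∀ s, σ s 0 = t 0 + (s.1 - 1 / 2) * r := fun s => by
    simp [hσdef, planePatch, hk.symm, hj.symm]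
  have hσ1 : ∀ s, fderiv ℝ σ s (1, 0) = Pi.single j 1 + r • Pi.single 0 1 := fun s => by
    rw [hσdef, fderiv_planePatch]
    simp
  have hσ2 : ∀ s, fderiv ℝ σ s (0, 1) = Pi.single k 1 := fun s => by
    rw [hσdef, fderiv_planePatch]
    simp
  -- A left inverse of the patch that ignores x: it extends g off the plane and confines the support
  -- of the variation.
  let B : (Fin N → ℝ) → ℝ × ℝ := fun y => (y j - t j + 1 / 2, y k - t k + 1 / 2)
  have hB : ContDiff ℝ ∞ B := by
    unfold B
    fun_prop
  have hBσ : ∀ s, B (σ s) = s := fun s => by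
    simp only [B, hσj, hσk]
    ext <;> simp
  let φ : smoothFields N := ⟨g ∘ B, hg.comp hB⟩
  let l : smoothFields N := ⟨fun y => (y 0 - t 0) - r * (y j - t j),
    show ContDiff ℝ ∞ (fun y : Fin N → ℝ => (y 0 - t 0) - r * (y j - t j)) by fun_prop⟩
  have hφσ : ∀ s, (φ : (Fin N → ℝ) → ℝ) (σ s) = g s := fun s => by
    change g (B (σ s)) = g s
    rw [hBσ]
  have hlσ : ∀ s, (l : (Fin N → ℝ) → ℝ) (σ s) = 0 := fun s => by
    change (σ s 0 - t 0) - r * (σ s j - t j) = 0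
    rw [hσ0, hσj]
    ring
  have hl : ∀ i, fieldDeriv i l = algebraMap ℝ _ ((Pi.single i 1 : Fin N → ℝ) 0
      - r * (Pi.single i 1 : Fin N → ℝ) j) := fun i => by
    ext y
    have h1 : ∀ a : Fin N, HasFDerivAt (fun y : Fin N → ℝ => y a - t a)
        (ContinuousLinearMap.proj a : (Fin N → ℝ) →L[ℝ] ℝ) y := fun a =>
      (ContinuousLinearMap.proj (R := ℝ) (φ := fun _ : Fin N => ℝ) a).hasFDerivAt.sub_const _
    have h2 : HasFDerivAt (fun y : Fin N → ℝ => (y 0 - t 0) - r * (y j - t j))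
        (ContinuousLinearMap.proj 0 - r • ContinuousLinearMap.proj j : (Fin N → ℝ) →L[ℝ] ℝ) y :=
      (h1 0).sub ((h1 j).const_mul r)
    change fderiv ℝ (fun y => (y 0 - t 0) - r * (y j - t j)) y (Pi.single i 1) = _
    rw [h2.fderiv]
    rfl
  have hφ0 : fieldDeriv 0 φ = 0 := by
    ext y
    change fderiv ℝ (g ∘ B) y (Pi.single 0 1) = 0
    have hBd : HasFDerivAt B ((ContinuousLinearMap.proj j : (Fin N → ℝ) →L[ℝ] ℝ).prod
        (ContinuousLinearMap.proj k : (Fin N → ℝ) →L[ℝ] ℝ)) y := by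
      refine HasFDerivAt.prodMk ?_ ?_
      · exact ((ContinuousLinearMap.proj (R := ℝ) (φ := fun _ : Fin N => ℝ)
          j).hasFDerivAt.sub_const _).add_const _
      · exact ((ContinuousLinearMap.proj (R := ℝ) (φ := fun _ : Fin N => ℝ)
          k).hasFDerivAt.sub_const _).add_const _
    rw [fderiv_comp _ (hg.differentiable (by simp) _) hBd.differentiableAt, hBd.fderiv]
    simp only [ContinuousLinearMap.comp_apply, ContinuousLinearMap.prod_apply,
      ContinuousLinearMap.proj_apply, Pi.single_eq_of_ne hj, Pi.single_eq_of_ne hk]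
    exact map_zero _
  obtain ⟨z, hz⟩ := exists_variation_plane hj hk hjk v (l := l) (φ := φ) (r := r)
    (by rw [hl]; simp [hj]) (by rw [hl]; simp [hj.symm])
    (by rw [hl]; simp [hk.symm, hjk]) hφ0 _ _ rfl rfl
  set cj := evalField v (varDeriv₁ 0 (kdvH N (j + 1)) (idx 0 2))
  set ck := evalField v (varDeriv₁ 0 (kdvH N (k + 1)) (idx 0 2))
  rw [← hX] at hz
  have hcrit := hv σ hσ (l * φ : smoothFields N) (contDiff_smoothField _) fun s hs => by
    have hsub : tsupport ((l * φ : smoothFields N) : (Fin N → ℝ) → ℝ) ⊆ B ⁻¹' (tsupport g) := by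
      refine closure_minimal (fun y hy => subset_tsupport g fun h => hy ?_)
        ((isClosed_tsupport g).preimage hB.continuous)
      change _ * g (B y) = 0
      rw [h, mul_zero]
    intro h
    have h1 := hgs (hsub h)
    rw [hBσ] at h1
    exact (mem_frontier_unitSquare.mp hs).2 h1
  rw [actionVariation_eq kdvLagrangian_swap] at hcrit
  -- The primitive of the exact part; its x-component is zero, so tilting the plane adds only the
  -- x-derivative of the component θ_k.
  let θ : Fin N → smoothFields N := fun i => if i = j then -(φ * cj) else if i = k then -(φ * ck)
    else 0
  have hθj : θ j = -(φ * cj) := if_pos rfl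
  have hθk : θ k = -(φ * ck) := by simp [θ, hjk.symm]
  have hθ0 : θ 0 = 0 := by simp [θ, hj.symm, hk.symm]
  have hstokes := integral_extDeriv_eq_zero θ hσc fun s hs i => by
    have hgs0 : g s = 0 := by
      by_contra h
      exact (mem_frontier_unitSquare.mp hs).2 (hgs (subset_tsupport g h))
    have h1 : ∀ c : smoothFields N, ((-(φ * c) : smoothFields N) : (Fin N → ℝ) → ℝ) (σ s) = 0 := by
      intro c
      change -((φ : (Fin N → ℝ) → ℝ) (σ s) * _) = 0
      rw [hφσ, hgs0, zero_mul, neg_zero]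
    simp only [θ]
    split_ifs
    · exact h1 _
    · exact h1 _
    · rfl
  simp only [hσ1, hσ2] at hcrit hstokes
  simp only [sum_sum_mul_single (fun a b => (variation v (l * φ) (kdvLagrangian N a b) :
    (Fin N → ℝ) → ℝ) (σ _))] at hcrit
  simp only [sum_sum_mul_single (fun a b => ((fieldDeriv a (θ b) - fieldDeriv b (θ a) :
    smoothFields N) : (Fin N → ℝ) → ℝ) (σ _)), hθj, hθk, hθ0, map_zero, sub_zero] at hstokes
  have hsplit : ∀ s, (variation v (l * φ) (kdvLagrangian N j k) : (Fin N → ℝ) → ℝ) (σ s)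
        + r * (variation v (l * φ) (kdvLagrangian N 0 k) : (Fin N → ℝ) → ℝ) (σ s)
      = (((fieldDeriv j (-(φ * ck)) - fieldDeriv k (-(φ * cj)) : smoothFields N) :
          (Fin N → ℝ) → ℝ) (σ s)
        + r * (fieldDeriv 0 (-(φ * ck)) : (Fin N → ℝ) → ℝ) (σ s))
        + g s * ((X + algebraMap ℝ _ (r / 2) * evalField v (pkdv N k) : smoothFields N) :
          (Fin N → ℝ) → ℝ) (σ s) := by
    intro s
    have h1 := congrArg (fun f : smoothFields N => (f : (Fin N → ℝ) → ℝ) (σ s)) hz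
    refine h1.trans ?_
    change (_ + _ + (φ : (Fin N → ℝ) → ℝ) (σ s) * _) + (l : (Fin N → ℝ) → ℝ) (σ s) * _ = _
    rw [hφσ, hlσ, zero_mul, add_zero]
    rfl
  have hcont : ∀ f : smoothFields N, Continuous fun s => (f : (Fin N → ℝ) → ℝ) (σ s) := fun f =>
    (contDiff_smoothField f).continuous.comp hσc.continuous
  simp only [hsplit] at hcrit
  rw [MeasureTheory.integral_add, hstokes, zero_add] at hcrit
  · exact hcrit
  · exact ((hcont _).add (continuous_const.mul (hcont _))).continuousOn.integrableOn_compact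
      isCompact_Icc
  · exact (hg.continuous.mul (hcont _)).continuousOn.integrableOn_compact isCompact_Icc

/-- N ≥ 3 provides a direction t_j besides x and t_k. Varying the slope r separates E_k from the
unknown X. -/
theorem isSolution_of_solvesPluriLagrangian (hN : 3 ≤ N) {v : smoothFields N}
    (hv : SolvesPluriLagrangian (kdvLagrangian N) v) : IsSolution (pkdvSystem N) v := by
  rw [isSolution_iff]
  rintro _ ⟨k, hk, rfl⟩
  obtain ⟨j, hj, hjk⟩ := exists_ne_zero_ne hN k
  ext t
  set X : smoothFields N := evalField v (MvPolynomial.pderiv (idx 0 1) (kdvLagrangian N j k))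
      + fieldDeriv j (evalField v (varDeriv₁ 0 (kdvH N (k + 1)) (idx 0 2)))
      - fieldDeriv k (evalField v (varDeriv₁ 0 (kdvH N (j + 1)) (idx 0 2))) with hX
  have key : ∀ r : ℝ, (X : (Fin N → ℝ) → ℝ) t
      + r / 2 * (evalField v (pkdv N k) : (Fin N → ℝ) → ℝ) t = 0 := by
    intro r
    set F : ℝ × ℝ → ℝ := fun s =>
      ((X + algebraMap ℝ _ (r / 2) * evalField v (pkdv N k) : smoothFields N) : (Fin N → ℝ) → ℝ)
        (planePatch t (Pi.single j 1 + r • Pi.single 0 1) (Pi.single k 1) s) with hF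
    have hFc : Continuous F :=
      (contDiff_smoothField _).continuous.comp (contDiff_planePatch _ _ _).continuous
    have hU : IsOpen (Set.Ioo (0 : ℝ) 1 ×ˢ Set.Ioo (0 : ℝ) 1) := isOpen_Ioo.prod isOpen_Ioo
    -- The fundamental lemma gives vanishing almost everywhere on the open square; continuity
    -- extends it to the centre, which the patch maps to t.
    have hae := hU.ae_eq_zero_of_integral_contDiff_smul_eq_zero (μ := MeasureTheory.volume)
      (hFc.locallyIntegrable.locallyIntegrableOn _) fun g hg _ hgs => by
        have h := integral_eq_zero_of_solvesPluriLagrangian hv hj hk hjk t r g hg hgs X hX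
        rw [MeasureTheory.setIntegral_eq_integral_of_forall_compl_eq_zero] at h
        · exact h
        · intro s hs
          have : g s = 0 := by
            by_contra hgne
            have h1 := hgs (subset_tsupport g hgne)
            exact hs ⟨⟨h1.1.1.le, h1.2.1.le⟩, ⟨h1.1.2.le, h1.2.2.le⟩⟩
          rw [this, zero_mul]
    have heq := MeasureTheory.Measure.eqOn_open_of_ae_eq (g := fun _ => (0 : ℝ))
      ((MeasureTheory.ae_restrict_iff' hU.measurableSet).mpr hae) hU hFc.continuousOn
      continuousOn_const
    have h0 := heq (x := ((1 / 2 : ℝ), (1 / 2 : ℝ))) (by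
      constructor <;> constructor <;> norm_num)
    have hpt : planePatch t (Pi.single j 1 + r • Pi.single 0 1) (Pi.single k 1)
        ((1 / 2 : ℝ), (1 / 2 : ℝ)) = t := by
      simp [planePatch]
    simp only [hF, hpt] at h0
    exact h0
  -- Slope 0 gives X = 0 at t, and slope 1 then gives E_k = 0.
  have h0 := key 0
  have h1 := key 1
  change _ = (0 : ℝ)
  linarith

end Necessity

end PluriLagrangian

end

theorem mainTheorem1 (N : ℕ) [NeZero N] (hN : 3 ≤ N) :
    (∀ k : Fin N, k ≠ 0 →
      ∃ c : ℝ, c ≠ 0 ∧ c • pkdv N k ∈ multiTimeEL (kdvLagrangian N)) ∧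
    (∀ P ∈ multiTimeEL (kdvLagrangian N), P ∈ differentialIdeal (pkdvSystem N)) ∧
    (∀ v : (Fin N → ℝ) → ℝ, ContDiff ℝ ∞ v →
      ((SolvesPluriLagrangian (kdvLagrangian N) v ↔ IsSolution (multiTimeEL (kdvLagrangian N)) v) ∧
       (SolvesPluriLagrangian (kdvLagrangian N) v ↔ IsSolution (pkdvSystem N) v))) := by
  refine ⟨fun k hk => exists_smul_pkdv_mem_multiTimeEL hN hk,
    fun P hP => multiTimeEL_kdvLagrangian_subset hN hP, fun v hv => ?_⟩
  lift v to smoothFields N using hv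
  have h : SolvesPluriLagrangian (kdvLagrangian N) v ↔ IsSolution (pkdvSystem N) v :=
    ⟨isSolution_of_solvesPluriLagrangian hN, solvesPluriLagrangian_of_isSolution⟩
  exact ⟨h.trans (isSolution_multiTimeEL_iff hN v).symm, h⟩
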